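/- Let $n\ge 0$ and $k\ge 1$ be integers and let $\kappa=(\kappa_1,\kappa_2)\in\mathbb{C}^2$ be arbitrary. **Signed permutations.** Let $B_n$ be the group of permutations $\omega$ of $\{\pm1,\dots,\pm n\}$ with $\omega(-i)=-\omega(i)$, written as words $b_1\cdots b_n$ with $b_i=\omega(i)$, a negative letter $-j$ being written $\bar{j}$ ("barred"). Let $\tau_0$ be the transposition of $1$ and $-1$ and, for $1\le i\le n-1$, let $\tau_i$ exchange $i$ with $i+1$ and $-i$ with $-(i+1)$. Every $\omega\in B_n$ is uniquely a product $w_0w_1\cdots w_{n-1}$ (its normal form) with $$w_m\in\{1,\ \tau_m,\ \tau_m\tau_{m-1},\ \dots,\ \tau_m\cdots\tau_1\tau_0,\ \tau_m\cdots\tau_1\tau_0\tau_1,\ \dots,\ \tau_m\cdots\tau_1\tau_0\tau_1\cdots\tau_m\},$$ and $m_i(\omega)\in\{0,1\}$ is the number of occurrences of $\tau_0$ in $w_i$. **The algebras.** Let $\hat{\mathcal H}_n^{\kappa}$ be the unital associative $\mathbb{C}$-algebra generated by $x_1,\dots,x_n,s_1,\dots,s_{n-1}$ with the relations $(x_1-\kappa_1)(x_1-\kappa_2)=0$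 (if $n\geq 1$); $x_rs_l=s_lx_r$ for $r\ne l,l+1$; $x_rx_t=x_tx_r$; $x_{r+1}=s_rx_rs_r+s_r$; $s_i^2=1$; $s_is_j=s_js_i$ for $|i-j|>1$; $s_is_{i+1}s_i=s_{i+1}s_is_{i+1}$. Put $s_0:=x_1$ and, for $\omega\in B_n$ with normal form $\tau_{i_1}\cdots\tau_{i_p}$ (as a word), $s_\omega:=s_{i_1}\cdots s_{i_p}$. Let $\mathcal A_n^{\kappa}$ be the quotient of $\hat{\mathcal H}_n^{\kappa}$ by the relation $$(x_1s_1)^2=\kappa_1(1+\kappa_1)(s_1-1)+\kappa_1(s_1x_1s_1-s_1x_1)+(1+\kappa_1)(x_1-x_1s_1)+x_1s_1x_1$$ if $n\ge2$, and $\mathcal A_n^{\kappa}=\hat{\mathcal H}_n^{\kappa}$ if $n\le 1$. Let $\mathcal A_n^{\kappa,(k)}$ be the quotient of $\mathcal A_n^{\kappa}$ by the relation $\tilde F_{k+1}=0$ if $n>k$, where $$\tilde F_{k+1}=\sum_{\omega\in B_{k+1}}\Big(\prod_{i=0}^{k}(i-\kappa_2)^{1-m_i(\omega)}\Big)s_\omega$$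 (with $0^0=1$, and $B_{k+1}$ identified with the subgroup of $B_n$ fixing $k+2,\dots,n$), and $\mathcal A_n^{\kappa,(k)}=\mathcal A_n^{\kappa}$ if $n\le k$. **Theorem.** The set of all (images of) $s_\omega$, where $\omega$ runs over the elements of $B_n$ whose word has its barred numbers in decreasing order from left to right (that is, $\omega$ is $\bar1\bar2$-avoiding) and contains at most $k$ barred numbers, spans the vector space $\mathcal A_n^{\kappa,(k)}$ over $\mathbb{C}$. -/

import Mathlib

namespace FusedHecke

noncomputable section

/-! ### Signed permutations -/

/-- The letters `±1, …, ±n`: the pair `(a, ε)` stands for the integer `ε (a + 1)`. -/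
abbrev Letter (n : ℕ) : Type := Fin n × ℤˣ

/-- The Coxeter group of type `B_n`: the permutations `ω` of `{±1, …, ±n}` with `ω (-i) = - ω i`,
with composition of maps as product. -/
def B (n : ℕ) : Subgroup (Equiv.Perm (Letter n)) where
  carrier := {ω | ∀ (a : Fin n) (ε : ℤˣ), ω (a, -ε) = ((ω (a, ε)).1, -(ω (a, ε)).2)}
  one_mem' := by intro a ε; rfl
  mul_mem' := by
    intro u v hu hv a ε
    simp only [Set.mem_ofPred_eq] at hu hv
    rw [Equiv.Perm.mul_apply, Equiv.Perm.mul_apply, hv a ε]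
    exact hu _ _
  inv_mem' := by
    intro u hu a ε
    simp only [Set.mem_ofPred_eq] at hu
    rw [Equiv.Perm.inv_eq_iff_eq, hu]
    simp

instance (n : ℕ) : DecidablePred (· ∈ B n) := fun ω =>
  inferInstanceAs (Decidable (∀ (a : Fin n) (ε : ℤˣ),
    ω (a, -ε) = ((ω (a, ε)).1, -(ω (a, ε)).2)))

instance (n : ℕ) : Fintype (B n) :=
  inferInstanceAs (Fintype {ω : Equiv.Perm (Letter n) // ω ∈ B n})

/-- `τ_0` exchanges `1` and `-1`; for `1 ≤ i < n`, `τ_i` exchanges `i` and `i + 1`, and `-i` and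
`-(i + 1)`. -/
def τ {n : ℕ} (i : Fin n) : B n :=
  if i.val = 0 then
    ⟨Equiv.swap (i, 1) (i, -1), by
      intro a ε
      by_cases h : a = i
      · subst h
        rcases Int.units_eq_one_or ε with rfl | rfl <;> simp
      · rw [Equiv.swap_apply_of_ne_of_ne, Equiv.swap_apply_of_ne_of_ne] <;> simp [h]⟩
  else
    ⟨Equiv.prodCongr (Equiv.swap ⟨i.val - 1, by omega⟩ i) (Equiv.refl ℤˣ), by
      intro a ε; rfl⟩

/-! ### The normal form -/

/-- For `0 ≤ m < n` and `0 ≤ j ≤ 2 m + 1`, the word made of the first `j` indices of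
`m, m - 1, …, 1, 0, 1, …, m`. -/
def factorWord {n : ℕ} (m : Fin n) (j : Fin (2 * m.val + 2)) : List (Fin n) :=
  List.ofFn fun t : Fin j.val => ⟨((m.val : ℤ) - (t.val : ℤ)).natAbs, by omega⟩

/-- A choice, for each `m = 0, …, n - 1`, of an element of the `m`-th set
`{1, τ_m, τ_m τ_{m-1}, …, τ_m ⋯ τ_1 τ_0, τ_m ⋯ τ_1 τ_0 τ_1, …, τ_m ⋯ τ_1 τ_0 τ_1 ⋯ τ_m}`,
given by the length of that element. -/
abbrev NormalForm (n : ℕ) : Type := (m : Fin n) → Fin (2 * m.val + 2)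

/-- The word of a normal form: the chosen words for `m = 0, 1, …, n - 1`, in this order. -/
def NormalForm.word {n : ℕ} (c : NormalForm n) : List (Fin n) :=
  (List.ofFn fun m : Fin n => factorWord m (c m)).flatten

/-- The signed permutation written by a normal form. -/
def NormalForm.toB {n : ℕ} (c : NormalForm n) : B n := (c.word.map τ).prod

theorem tau_apply_zero {n : ℕ} (i : Fin n) (hi : i.val = 0) (ε : ℤˣ) :
    (τ i : Equiv.Perm (Letter n)) (i, ε) = (i, -ε) := by
  unfold τ
  rw [if_pos hi]
  rcases Int.units_eq_one_or ε with rfl | rfl <;> simp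

theorem tau_apply_pred {n : ℕ} (i a : Fin n) (hi : i.val = a.val + 1) (ε : ℤˣ) :
    (τ i : Equiv.Perm (Letter n)) (a, ε) = (i, ε) := by
  have ha : a = ⟨i.val - 1, by omega⟩ := Fin.ext (by simp; omega)
  unfold τ
  rw [if_neg (by omega)]
  simp [ha]

theorem tau_apply_self {n : ℕ} (i a : Fin n) (hi : i.val = a.val + 1) (ε : ℤˣ) :
    (τ i : Equiv.Perm (Letter n)) (i, ε) = (a, ε) := by
  have ha : a = ⟨i.val - 1, by omega⟩ := Fin.ext (by simp; omega)
  unfold τ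
  rw [if_neg (by omega)]
  simp [ha]

theorem tau_apply_of_lt {n : ℕ} (i a : Fin n) (h : i < a) (ε : ℤˣ) :
    (τ i : Equiv.Perm (Letter n)) (a, ε) = (a, ε) := by
  have h' : i.val < a.val := h
  unfold τ
  split_ifs with hi
  · have : a ≠ i := ne_of_gt h
    exact Equiv.swap_apply_of_ne_of_ne (by simp [this]) (by simp [this])
  · have h1 : a ≠ i := ne_of_gt h
    have h2 : a ≠ ⟨i.val - 1, by omega⟩ := fun e => by
      have := congrArg Fin.val e
      simp at this
      omega
    simp [Equiv.swap_apply_of_ne_of_ne h2 h1]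

/-- The `m`-th factor of a normal form, as a signed permutation. -/
def factorB {n : ℕ} (m : Fin n) (j : Fin (2 * m.val + 2)) : B n := ((factorWord m j).map τ).prod

theorem toB_eq {n : ℕ} (c : NormalForm n) :
    c.toB = (List.ofFn fun m => factorB m (c m)).prod := by
  unfold NormalForm.toB NormalForm.word
  rw [List.map_flatten, List.prod_flatten, List.map_map, List.map_ofFn]
  rfl

theorem prod_map_tau_apply {n : ℕ} (l : List (Fin n)) (a : Fin n) (h : ∀ i ∈ l, i < a) (ε : ℤˣ) :
    ((l.map τ).prod : B n).1 (a, ε) = (a, ε) := by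
  induction l with
  | nil => rfl
  | cons i l ih =>
    rw [List.map_cons, List.prod_cons, Subgroup.coe_mul, Equiv.Perm.mul_apply,
      ih fun i hi => h i (List.mem_cons_of_mem _ hi)]
    exact tau_apply_of_lt i a (h i List.mem_cons_self) ε

theorem factorB_apply_of_lt {n : ℕ} (m : Fin n) (j : Fin (2 * m.val + 2)) (a : Fin n) (h : m < a)
    (ε : ℤˣ) : (factorB m j).1 (a, ε) = (a, ε) := by
  refine prod_map_tau_apply _ a ?_ ε
  intro i hi
  unfold factorWord at hi
  rw [List.mem_ofFn] at hi
  obtain ⟨t, rfl⟩ := hi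
  have h' : m.val < a.val := h
  change _ < a.val
  simp only
  omega

/-- The letter that the `m`-th factor of length `j` sends to `m + 1`. -/
def source {n : ℕ} (m : Fin n) (j : Fin (2 * m.val + 2)) : Letter n :=
  if j.val ≤ m.val then (⟨m.val - j.val, by omega⟩, 1) else (⟨j.val - m.val - 1, by omega⟩, -1)

theorem source_injective {n : ℕ} (m : Fin n) : Function.Injective (source m) := by
  intro i j h
  unfold source at h
  have hne : (1 : ℤˣ) ≠ -1 := by decide
  split_ifs at h with h1 h2 h2
  · simp only [Prod.mk.injEq, Fin.mk.injEq, and_true] at h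
    exact Fin.ext (by omega)
  · exact absurd (congrArg Prod.snd h) hne
  · exact absurd (congrArg Prod.snd h).symm hne
  · simp only [Prod.mk.injEq, Fin.mk.injEq, and_true] at h
    exact Fin.ext (by omega)

theorem factorB_source {n : ℕ} (m : Fin n) (j : ℕ) (hj : j < 2 * m.val + 2) :
    (factorB m ⟨j, hj⟩).1 (source m ⟨j, hj⟩) = (m, 1) := by
  induction j with
  | zero => simp [factorB, factorWord, source]
  | succ j ih =>
    have hlast : factorB m ⟨j + 1, hj⟩ = factorB m ⟨j, by omega⟩ *
        τ ⟨((m.val : ℤ) - (j : ℤ)).natAbs, by omega⟩ := by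
      unfold factorB factorWord
      simp only
      rw [List.ofFn_succ_last]
      simp
    rw [hlast, Subgroup.coe_mul, Equiv.Perm.mul_apply]
    have hτ : (τ (⟨((m.val : ℤ) - (j : ℤ)).natAbs, by omega⟩ : Fin n)).1 (source m ⟨j + 1, hj⟩) =
        source m ⟨j, by omega⟩ := by
      unfold source
      simp only
      rcases lt_trichotomy j m.val with h | h | h
      · rw [if_pos (by omega), if_pos (by omega), tau_apply_pred _ _ (by simp only; omega)]
        ext
        · simp only; omega
        · rfl
      · rw [if_neg (by omega), if_pos (by omega)]
        have e : (⟨((m.val : ℤ) - (j : ℤ)).natAbs, by omega⟩ : Fin n) =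
          ⟨j + 1 - m.val - 1, by omega⟩ := Fin.ext (by simp only; omega)
        rw [e, tau_apply_zero _ (by simp only; omega)]
        ext
        · simp only; omega
        · simp
      · rw [if_neg (by omega), if_neg (by omega)]
        have e : (⟨((m.val : ℤ) - (j : ℤ)).natAbs, by omega⟩ : Fin n) =
          ⟨j + 1 - m.val - 1, by omega⟩ := Fin.ext (by simp only; omega)
        rw [e, tau_apply_self _ ⟨j - m.val - 1, by omega⟩ (by simp only; omega)]
    rw [hτ]
    exact ih _

theorem partialProd_apply {n : ℕ} (c : NormalForm n) (p : ℕ) (hp : p < n + 1) (a : Fin n)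
    (ha : p ≤ a.val) (ε : ℤˣ) :
    (Fin.partialProd (fun m => factorB m (c m)) ⟨p, hp⟩).1 (a, ε) = (a, ε) := by
  induction p with
  | zero => rw [Fin.mk_zero, Fin.partialProd_zero]; rfl
  | succ p ih =>
    have h := Fin.partialProd_succ (fun m => factorB m (c m)) ⟨p, by omega⟩
    simp only [Fin.succ_mk, Fin.castSucc_mk] at h
    rw [h, Subgroup.coe_mul, Equiv.Perm.mul_apply,
      factorB_apply_of_lt _ _ _ (Fin.lt_def.mpr (by simp only; omega)), ih _ (by omega)]

theorem partialProd_inj {n : ℕ} (c d : NormalForm n) (p : ℕ) (hp : p < n + 1)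
    (h : Fin.partialProd (fun m => factorB m (c m)) ⟨p, hp⟩ =
      Fin.partialProd (fun m => factorB m (d m)) ⟨p, hp⟩) (i : Fin n) (hi : i.val < p) :
    c i = d i := by
  induction p with
  | zero => omega
  | succ p ih =>
    have hc := Fin.partialProd_succ (fun m => factorB m (c m)) ⟨p, by omega⟩
    have hd := Fin.partialProd_succ (fun m => factorB m (d m)) ⟨p, by omega⟩
    simp only [Fin.succ_mk, Fin.castSucc_mk] at hc hd
    have key : c ⟨p, by omega⟩ = d ⟨p, by omega⟩ := by
      apply source_injective
      apply (Fin.partialProd (fun m => factorB m (c m)) ⟨p + 1, hp⟩).1.injective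
      conv_rhs => rw [h]
      rw [hc, hd, Subgroup.coe_mul, Subgroup.coe_mul, Equiv.Perm.mul_apply, Equiv.Perm.mul_apply,
        factorB_source _ _ (c ⟨p, by omega⟩).2, factorB_source _ _ (d ⟨p, by omega⟩).2,
        partialProd_apply c p _ _ le_rfl, partialProd_apply d p _ _ le_rfl]
    rcases Nat.lt_succ_iff_lt_or_eq.mp hi with hlt | heq
    · refine ih (by omega) ?_ hlt
      rw [hc, hd, key] at h
      exact mul_right_cancel h
    · have : i = ⟨p, by omega⟩ := Fin.ext heq
      rw [this, key]

theorem toB_injective (n : ℕ) : Function.Injective (NormalForm.toB (n := n)) := by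
  intro c d h
  funext i
  refine partialProd_inj c d n (by omega) ?_ i i.2
  rw [toB_eq, toB_eq] at h
  unfold Fin.partialProd
  simpa [List.take_of_length_le] using h

theorem card_B_le (n : ℕ) : Fintype.card (B n) ≤ Fintype.card (NormalForm n) := by
  have hcard : Fintype.card (NormalForm n) = Fintype.card ((Fin n ↪ Fin n) × (Fin n → ℤˣ)) := by
    rw [Fintype.card_pi, Fintype.card_prod, Fintype.card_embedding_eq, Fintype.card_fun]
    simp only [Fintype.card_fin, Nat.descFactorial_self, Fintype.card_units_int]
    rw [Fin.prod_univ_eq_prod_range (fun m => 2 * m + 2) n,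
      ← Finset.prod_range_add_one_eq_factorial, mul_comm]
    simp only [← mul_add_one, Finset.prod_mul_distrib, Finset.prod_const, Finset.card_range]
  rw [hcard]
  have hω (ω : B n) (a : Fin n) : ω.1 (a, -1) = ((ω.1 (a, 1)).1, -(ω.1 (a, 1)).2) := ω.2 a 1
  refine Fintype.card_le_of_injective
    (fun ω => (⟨fun a => (ω.1 (a, 1)).1, ?_⟩, fun a => (ω.1 (a, 1)).2)) ?_
  · intro a b hab
    simp only at hab
    by_cases hs : (ω.1 (a, 1)).2 = (ω.1 (b, 1)).2
    · have := ω.1.injective (Prod.ext hab hs)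
      exact congrArg Prod.fst this
    · have hs' : (ω.1 (a, 1)).2 = -(ω.1 (b, 1)).2 := Int.units_ne_iff_eq_neg.mp hs
      have : ω.1 (a, 1) = ω.1 (b, -1) := by
        rw [hω ω b]
        exact Prod.ext hab hs'
      exact congrArg Prod.fst (ω.1.injective this)
  · intro u v huv
    rw [Prod.mk.injEq] at huv
    have h1 (a : Fin n) : u.1 (a, 1) = v.1 (a, 1) :=
      Prod.ext (DFunLike.congr_fun huv.1 a) (congrFun huv.2 a)
    apply Subtype.ext
    ext1 ⟨a, ε⟩
    rcases Int.units_eq_one_or ε with rfl | rfl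
    · exact h1 a
    · rw [hω u, hω v, h1]

theorem toB_bijective (n : ℕ) : Function.Bijective (NormalForm.toB (n := n)) :=
  (Fintype.bijective_iff_injective_and_card _).mpr
    ⟨toB_injective n, le_antisymm (Fintype.card_le_of_injective _ (toB_injective n)) (card_B_le n)⟩

/-- The normal form of a signed permutation: the only one that writes it. -/
def normalForm {n : ℕ} (ω : B n) : NormalForm n :=
  (Equiv.ofBijective _ (toB_bijective n)).symm ω

theorem toB_normalForm {n : ℕ} (ω : B n) : (normalForm ω).toB = ω :=
  (Equiv.ofBijective _ (toB_bijective n)).apply_symm_apply ω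

/-- `m_i(ω)`: `1` if the index `0` occurs in the `i`-th factor of the normal form of `ω`,
and `0` otherwise. -/
def occ {n : ℕ} (ω : B n) (i : Fin n) : ℕ :=
  if ∃ t ∈ factorWord i (normalForm ω i), t.val = 0 then 1 else 0

/-! ### Words, barred letters, and pattern avoidance -/

/-- In the word `b_1 … b_n` of `ω`, where `b_i = ω(i)`, the letter in position `a + 1` is barred,
that is, negative. -/
def IsBarred {n : ℕ} (ω : B n) (a : Fin n) : Prop := (ω.1 (a, 1)).2 = -1

instance {n : ℕ} (ω : B n) : DecidablePred (IsBarred ω) := fun a =>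
  inferInstanceAs (Decidable ((ω.1 (a, 1)).2 = -1))

/-- The barred numbers of the word of `ω` appear in decreasing order (of absolute values). -/
def AvoidsBarOneTwo {n : ℕ} (ω : B n) : Prop :=
  ∀ a b : Fin n, a < b → IsBarred ω a → IsBarred ω b → (ω.1 (b, 1)).1 < (ω.1 (a, 1)).1

/-- The signed permutations whose words have their barred numbers in decreasing order, and at most
`k` of them. -/
def avoiding (n k : ℕ) : Set (B n) :=
  {ω | AvoidsBarOneTwo ω ∧ (Finset.univ.filter (IsBarred ω)).card ≤ k}

/-! ### The cyclotomic degenerate affine Hecke algebra -/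

/-- The generators `x_1, …, x_n` and `s_1, …, s_{n-1}`. -/
inductive Gen (n : ℕ) : Type
  | x (r : ℕ) (h₁ : 1 ≤ r) (h₂ : r ≤ n) : Gen n
  | s (i : ℕ) (h₁ : 1 ≤ i) (h₂ : i < n) : Gen n

/-- `x_r` in the free algebra. -/
def freeX {n : ℕ} (r : ℕ) (h₁ : 1 ≤ r) (h₂ : r ≤ n) : FreeAlgebra ℂ (Gen n) :=
  FreeAlgebra.ι ℂ (Gen.x r h₁ h₂)

/-- `s_i` in the free algebra. -/
def freeS {n : ℕ} (i : ℕ) (h₁ : 1 ≤ i) (h₂ : i < n) : FreeAlgebra ℂ (Gen n) :=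
  FreeAlgebra.ι ℂ (Gen.s i h₁ h₂)

/-- The defining relations of the cyclotomic degenerate affine Hecke algebra. -/
inductive HeckeRel (κ : ℂ × ℂ) (n : ℕ) :
    FreeAlgebra ℂ (Gen n) → FreeAlgebra ℂ (Gen n) → Prop
  | quadratic (hn : 1 ≤ n) :
      HeckeRel κ n
        ((freeX 1 le_rfl hn - algebraMap ℂ _ κ.1) * (freeX 1 le_rfl hn - algebraMap ℂ _ κ.2)) 0
  | x_comm_s (r l : ℕ) (hr₁ : 1 ≤ r) (hr₂ : r ≤ n) (hl₁ : 1 ≤ l) (hl₂ : l < n)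
      (h : r ≠ l) (h' : r ≠ l + 1) :
      HeckeRel κ n (freeX r hr₁ hr₂ * freeS l hl₁ hl₂) (freeS l hl₁ hl₂ * freeX r hr₁ hr₂)
  | x_comm_x (r t : ℕ) (hr₁ : 1 ≤ r) (hr₂ : r ≤ n) (ht₁ : 1 ≤ t) (ht₂ : t ≤ n) :
      HeckeRel κ n (freeX r hr₁ hr₂ * freeX t ht₁ ht₂) (freeX t ht₁ ht₂ * freeX r hr₁ hr₂)
  | x_succ (r : ℕ) (hr₁ : 1 ≤ r) (hr₂ : r < n) :
      HeckeRel κ n (freeX (r + 1) (Nat.le_add_left 1 r) hr₂)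
        (freeS r hr₁ hr₂ * freeX r hr₁ hr₂.le * freeS r hr₁ hr₂ + freeS r hr₁ hr₂)
  | s_sq (i : ℕ) (h₁ : 1 ≤ i) (h₂ : i < n) : HeckeRel κ n (freeS i h₁ h₂ ^ 2) 1
  | s_comm (i j : ℕ) (hi₁ : 1 ≤ i) (hi₂ : i < n) (hj₁ : 1 ≤ j) (hj₂ : j < n)
      (h : 1 < |(i : ℤ) - (j : ℤ)|) :
      HeckeRel κ n (freeS i hi₁ hi₂ * freeS j hj₁ hj₂) (freeS j hj₁ hj₂ * freeS i hi₁ hi₂)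
  | braid (i : ℕ) (h₁ : 1 ≤ i) (h₂ : i + 1 < n) :
      HeckeRel κ n
        (freeS i h₁ (Nat.lt_of_succ_lt h₂) * freeS (i + 1) (Nat.le_add_left 1 i) h₂ *
          freeS i h₁ (Nat.lt_of_succ_lt h₂))
        (freeS (i + 1) (Nat.le_add_left 1 i) h₂ * freeS i h₁ (Nat.lt_of_succ_lt h₂) *
          freeS (i + 1) (Nat.le_add_left 1 i) h₂)

/-- The cyclotomic degenerate affine Hecke algebra with parameters `κ = (κ_1, κ_2)`. -/
abbrev Hecke (κ : ℂ × ℂ) (n : ℕ) : Type := RingQuot (HeckeRel κ n)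

/-- The generator `x_r` of the Hecke algebra. -/
def heckeX (κ : ℂ × ℂ) (n r : ℕ) (h₁ : 1 ≤ r) (h₂ : r ≤ n) : Hecke κ n :=
  RingQuot.mkAlgHom ℂ (HeckeRel κ n) (freeX r h₁ h₂)

/-- The generator `s_i` of the Hecke algebra. -/
def heckeS (κ : ℂ × ℂ) (n i : ℕ) (h₁ : 1 ≤ i) (h₂ : i < n) : Hecke κ n :=
  RingQuot.mkAlgHom ℂ (HeckeRel κ n) (freeS i h₁ h₂)

/-- The generators indexed by `0, …, n - 1`, with `s_0 := x_1`. -/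
def heckeGen (κ : ℂ × ℂ) (n : ℕ) (i : Fin n) : Hecke κ n :=
  if h : i.val = 0 then heckeX κ n 1 le_rfl (by omega)
  else heckeS κ n i.val (Nat.one_le_iff_ne_zero.mpr h) i.2

/-- `s_ω = s_{i_1} ⋯ s_{i_p}`, where `τ_{i_1} ⋯ τ_{i_p}` is the normal form of `ω`. -/
def sElt (κ : ℂ × ℂ) {n : ℕ} (ω : B n) : Hecke κ n :=
  ((normalForm ω).word.map (heckeGen κ n)).prod

/-- The element `F̃_m = ∑_{ω ∈ B_m} (∏_{i=0}^{m-1} (i - κ_2)^{1 - m_i(ω)}) s_ω` for `m ≤ n`, where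
`B_m` is seen as the subgroup of the elements of `B_n` that fix `m + 1, …, n`. -/
def Ftilde (κ : ℂ × ℂ) (n m : ℕ) : Hecke κ n :=
  ∑ ω : B n with ∀ a : Fin n, m ≤ a.val → ω.1 (a, 1) = (a, 1),
    (∏ i : Fin n with i.val < m, ((i.val : ℂ) - κ.2) ^ (1 - occ ω i)) • sElt κ ω

/-! ### The two quotients -/

/-- The relation that defines `A_n^κ`; there is none for `n = 0, 1`. -/
inductive ARel (κ : ℂ × ℂ) (n : ℕ) : Hecke κ n → Hecke κ n → Prop
  | rel (hn : 2 ≤ n) (x s : Hecke κ n) (hx : x = heckeX κ n 1 le_rfl (Nat.le_of_succ_le hn))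
      (hs : s = heckeS κ n 1 le_rfl hn) :
      ARel κ n ((x * s) ^ 2)
        ((κ.1 * (1 + κ.1)) • (s - 1) + κ.1 • (s * x * s - s * x) + (1 + κ.1) • (x - x * s)
          + x * s * x)

/-- The algebra `A_n^κ`. -/
abbrev A (κ : ℂ × ℂ) (n : ℕ) : Type := RingQuot (ARel κ n)

/-- The relation `F̃_{k+1} = 0` in `A_n^κ` for `n > k`; there is none for `n ≤ k`. -/
inductive AkRel (κ : ℂ × ℂ) (n k : ℕ) : A κ n → A κ n → Prop
  | rel (h : k < n) : AkRel κ n k (RingQuot.mkAlgHom ℂ (ARel κ n) (Ftilde κ n (k + 1))) 0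

/-- The algebra `A_n^{κ,(k)}`. -/
abbrev Ak (κ : ℂ × ℂ) (n k : ℕ) : Type := RingQuot (AkRel κ n k)

/-- The canonical projection of the Hecke algebra onto `A_n^{κ,(k)}`. -/
def toAk (κ : ℂ × ℂ) (n k : ℕ) : Hecke κ n →ₐ[ℂ] Ak κ n k :=
  (RingQuot.mkAlgHom ℂ (AkRel κ n k)).comp (RingQuot.mkAlgHom ℂ (ARel κ n))

end

end FusedHecke

/-! Filter the algebra by the number of factors `s_0 = x_1`: `low g d` is the span of the words with
fewer than `d` letters `0`. To leading order the generators satisfy the type B braid relations,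
together with `s_i² = 1` for `i ≥ 1` and `s_0² = 0`: the quadratic relation lowers the degree, and
`x_1 x_2 = x_2 x_1` becomes the braid relation of length four. Rewriting a word as in the Coxeter
group therefore either lowers its degree or leads to a normal form
(`degenerate_or_leadEq_normalForm`). A normal form has as many letters `0` as its signed permutation
has bars (`zeros_natWord_normalForm`), so degree `d` is spanned, modulo lower degrees, by the `s_ω`
with `d` bars, and `s_u s_v s_w` agrees with `s_{uvw}` to leading order whenever the numbers of bars
add up (`basisElt_mul_mul`).

The relation for `(x_1 s_1)²` reads `x_1 s_1 x_1 s_1 ≡ x_1 s_1 x_1` in degree two. Carried to any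
two barred values by these products, it says that permuting the barred values of `ω` does not change
the leading term of `s_ω` (`basisElt_sub_swap_mul_mem_low`), so they can be put in decreasing order.

In `F̃_{k+1}` only the terms with all of `1, …, k+1` barred have degree `k+1`. Their coefficients
are `1` and their leading terms coincide, so a positive multiple of that common term has lower
degree, and hence so does the term (`basisElt_flip_mem_low`). Every `ω` with `k+1` bars has this
signed permutation as a factor, with bars adding up, whence `low (k+2) ≤ low (k+1)`. Thus `low
(k+1)` is a left ideal containing `1`, hence everything, and it is spanned by the avoiding `s_ω`
with at most `k` bars. -/

namespace FusedHecke

/-! ### Words in the generators and their reduction to normal form -/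

section Words

/-- The number of occurrences of the index `0` in a word. -/
def zeros (l : List ℕ) : ℕ := l.count 0

@[simp] theorem zeros_append (l l' : List ℕ) : zeros (l ++ l') = zeros l + zeros l' :=
  List.count_append

@[simp] theorem zeros_nil : zeros [] = 0 := rfl

theorem zeros_cons (i : ℕ) (l : List ℕ) : zeros (i :: l) = (if i = 0 then 1 else 0) + zeros l := by
  unfold zeros
  rw [List.count_cons]
  split_ifs <;> simp_all [add_comm]

/-- The product of the images of the letters of a word. -/
def wordProd {M : Type*} [Monoid M] (g : ℕ → M) (l : List ℕ) : M := (l.map g).prod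

section
variable {M : Type*} [Monoid M] (g : ℕ → M)

@[simp] theorem wordProd_append (l l' : List ℕ) :
    wordProd g (l ++ l') = wordProd g l * wordProd g l' := by simp [wordProd]

@[simp] theorem wordProd_nil : wordProd g [] = 1 := rfl

@[simp] theorem wordProd_cons (i : ℕ) (l : List ℕ) :
    wordProd g (i :: l) = g i * wordProd g l := by simp [wordProd]

end

/-! ### The filtration by the number of letters `0`, and agreement to leading order. -/

variable {R : Type*} [Ring R] [Algebra ℂ R] (g : ℕ → R)

/-- The span of the products of the words with fewer than `d` letters `0`. -/
def low (d : ℕ) : Submodule ℂ R := Submodule.span ℂ {a | ∃ l, zeros l < d ∧ wordProd g l = a}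

variable {g}

theorem wordProd_mem_low {l : List ℕ} {d : ℕ} (h : zeros l < d) : wordProd g l ∈ low g d :=
  Submodule.subset_span ⟨l, h, rfl⟩

theorem low_le {d : ℕ} {S : Submodule ℂ R} (h : ∀ l, zeros l < d → wordProd g l ∈ S) :
    low g d ≤ S :=
  Submodule.span_le.mpr fun _ ⟨l, hl, e⟩ => e ▸ h l hl

theorem wordProd_mul_mem_low (l : List ℕ) {d e : ℕ} (he : zeros l + d ≤ e) {a : R}
    (ha : a ∈ low g d) : wordProd g l * a ∈ low g e := by
  have : low g d ≤ (low g e).comap (LinearMap.mulLeft ℂ (wordProd g l)) := low_le fun l' h => by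
    rw [Submodule.mem_comap, LinearMap.mulLeft_apply, ← wordProd_append]
    exact wordProd_mem_low (by rw [zeros_append]; omega)
  exact this ha

theorem mul_wordProd_mem_low (l : List ℕ) {d e : ℕ} (he : d + zeros l ≤ e) {a : R}
    (ha : a ∈ low g d) : a * wordProd g l ∈ low g e := by
  have : low g d ≤ (low g e).comap (LinearMap.mulRight ℂ (wordProd g l)) := low_le fun l' h => by
    rw [Submodule.mem_comap, LinearMap.mulRight_apply, ← wordProd_append]
    exact wordProd_mem_low (by rw [zeros_append]; omega)
  exact this ha

/-- The relations of type `B` for `g 0, …, g (n - 1)`, those that involve `g 0` being required only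
modulo products with fewer factors `g 0`. -/
structure FilteredTypeB (n : ℕ) (g : ℕ → R) : Prop where
  -- The square of `g 0` vanishes to leading order, whereas `t 0` is an involution in the group:
  -- this mismatch is what `Degenerate` records.
  sq_zero : 0 < n → wordProd g [0, 0] ∈ low g 2
  sq : ∀ i, 1 ≤ i → i < n → g i * g i = 1
  comm : ∀ i j, i + 1 < j → j < n → g i * g j = g j * g i
  braid : ∀ i, 1 ≤ i → i + 1 < n → g i * g (i + 1) * g i = g (i + 1) * g i * g (i + 1)
  braid_zero : 1 < n → wordProd g [0, 1, 0, 1] - wordProd g [1, 0, 1, 0] ∈ low g 2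

/-- The relations of the Coxeter group of type `B`. -/
structure CoxeterTypeB {G : Type*} [Group G] (n : ℕ) (t : ℕ → G) : Prop where
  sq : ∀ i, i < n → t i * t i = 1
  comm : ∀ i j, i + 1 < j → j < n → t i * t j = t j * t i
  braid : ∀ i, 1 ≤ i → i + 1 < n → t i * t (i + 1) * t i = t (i + 1) * t i * t (i + 1)
  braid_zero : 1 < n → t 0 * t 1 * t 0 * t 1 = t 1 * t 0 * t 1 * t 0

variable {G : Type*} [Group G] (g) (t : ℕ → G)

/-- Two words agree to leading order if they have as many letters `0`, the same product in the
group, and the same product in the algebra modulo products with fewer factors `g 0`. -/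
structure LeadEq (l l' : List ℕ) : Prop where
  zeros_eq : zeros l = zeros l'
  group_eq : wordProd t l = wordProd t l'
  sub_mem : wordProd g l - wordProd g l' ∈ low g (zeros l)

/-- A word is degenerate if its product in the algebra is one of words with fewer letters `0`,
and its product in the group is that of such a word. -/
structure Degenerate (l : List ℕ) : Prop where
  mem_low : wordProd g l ∈ low g (zeros l)
  exists_lt : ∃ l', wordProd t l' = wordProd t l ∧ zeros l' < zeros l

variable {g t}

theorem LeadEq.refl (l : List ℕ) : LeadEq g t l l := ⟨rfl, rfl, by simp⟩

theorem LeadEq.of_eq {l l' : List ℕ} (h : l = l') : LeadEq g t l l' := h ▸ .refl l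

theorem LeadEq.symm {l l' : List ℕ} (h : LeadEq g t l l') : LeadEq g t l' l :=
  ⟨h.1.symm, h.2.symm, by rw [← h.1, ← neg_sub]; exact neg_mem h.3⟩

theorem LeadEq.trans {l l' l'' : List ℕ} (h : LeadEq g t l l') (h' : LeadEq g t l' l'') :
    LeadEq g t l l'' :=
  ⟨h.1.trans h'.1, h.2.trans h'.2, by
    rw [← sub_add_sub_cancel _ (wordProd g l') _]
    exact add_mem h.3 (h.1 ▸ h'.3)⟩

instance : Trans (LeadEq g t) (LeadEq g t) (LeadEq g t) := ⟨LeadEq.trans⟩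

theorem LeadEq.congr {l l' : List ℕ} (h : LeadEq g t l l') (a b : List ℕ) :
    LeadEq g t (a ++ l ++ b) (a ++ l' ++ b) where
  zeros_eq := by simp [h.1]
  group_eq := by simp [h.2]
  sub_mem := by
    have : wordProd g (a ++ l ++ b) - wordProd g (a ++ l' ++ b) =
        wordProd g a * (wordProd g l - wordProd g l') * wordProd g b := by
      simp only [wordProd_append]; noncomm_ring
    rw [this]
    exact mul_wordProd_mem_low b (by simp [add_assoc]) (wordProd_mul_mem_low a le_rfl h.3)

theorem LeadEq.append_right {l l' : List ℕ} (h : LeadEq g t l l') (b : List ℕ) :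
    LeadEq g t (l ++ b) (l' ++ b) := h.congr [] b

theorem LeadEq.append_left {l l' : List ℕ} (h : LeadEq g t l l') (a : List ℕ) :
    LeadEq g t (a ++ l) (a ++ l') := by simpa using h.congr a []

theorem Degenerate.congr {l : List ℕ} (h : Degenerate g t l) (a b : List ℕ) :
    Degenerate g t (a ++ l ++ b) where
  mem_low := by
    rw [wordProd_append, wordProd_append]
    exact mul_wordProd_mem_low b (by simp [add_assoc]) (wordProd_mul_mem_low a le_rfl h.1)
  exists_lt := by
    obtain ⟨l', e, hl⟩ := h.2
    exact ⟨a ++ l' ++ b, by simp [e], by simpa using hl⟩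

theorem Degenerate.of_leadEq {l l' : List ℕ} (h : Degenerate g t l') (e : LeadEq g t l l') :
    Degenerate g t l where
  mem_low := by
    rw [← sub_add_cancel (wordProd g l) (wordProd g l')]
    exact add_mem e.3 (e.1 ▸ h.1)
  exists_lt := by
    rw [e.1, e.2]; exact h.2

variable {n : ℕ}

/-! ### Moves on words, valid to leading order. -/

namespace LeadEq

theorem of_group_eq {l l' : List ℕ} (hz : zeros l = zeros l') (ht : wordProd t l = wordProd t l')
    (hg : wordProd g l = wordProd g l') : LeadEq g t l l' := ⟨hz, ht, by simp [hg]⟩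

variable (hg : FilteredTypeB n g) (ht : CoxeterTypeB n t)
include hg ht

theorem sq {i : ℕ} (h₁ : 1 ≤ i) (h : i < n) : LeadEq g t [i, i] [] :=
  of_group_eq (by simp [zeros_cons]; omega) (by simp [ht.sq i h]) (by simp [hg.sq i h₁ h])

theorem comm {i j : ℕ} (h : i + 1 < j ∨ j + 1 < i) (hi : i < n) (hj : j < n) :
    LeadEq g t [i, j] [j, i] := by
  rcases h with h | h
  · exact of_group_eq (by simp [zeros_cons, add_comm]) (by simp [ht.comm i j h hj])
      (by simp [hg.comm i j h hj])
  · exact of_group_eq (by simp [zeros_cons, add_comm]) (by simp [ht.comm j i h hi])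
      (by simp [hg.comm j i h hi])

theorem braid {i : ℕ} (h₁ : 1 ≤ i) (h : i + 1 < n) :
    LeadEq g t [i, i + 1, i] [i + 1, i, i + 1] := by
  refine of_group_eq (by simp [zeros_cons]; omega) ?_ ?_
  · simpa [mul_assoc] using ht.braid i h₁ h
  · simpa [mul_assoc] using hg.braid i h₁ h

theorem braid_zero (h : 1 < n) : LeadEq g t [1, 0, 1, 0] [0, 1, 0, 1] :=
  LeadEq.symm ⟨by simp [zeros_cons], by simpa [mul_assoc] using ht.braid_zero h,
    by simpa [zeros_cons] using hg.braid_zero h⟩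

theorem append_singleton_comm {L : List ℕ} {i : ℕ} (hi : i < n)
    (h : ∀ x ∈ L, x < n ∧ (x + 1 < i ∨ i + 1 < x)) : LeadEq g t (L ++ [i]) (i :: L) := by
  induction L with
  | nil => exact .refl _
  | cons a L ih =>
    have ha := h a List.mem_cons_self
    exact ((ih fun x hx => h x (List.mem_cons_of_mem _ hx)).append_left [a]).trans
      ((comm hg ht ha.2 ha.1 hi).append_right L)

/-- `s_m ⋯ s_b s_i = s_{i-1} s_m ⋯ s_b` for `b < i ≤ m`, with `i = b + p + 1`. -/
theorem reverse_range'_append {b p q : ℕ} (h₁ : 1 ≤ b + p) (h : b + p + 2 + q ≤ n) :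
    LeadEq g t ((List.range' b (p + 2 + q)).reverse ++ [b + p + 1])
      ((b + p) :: (List.range' b (p + 2 + q)).reverse) := by
  -- With `i = b + p + 1`, isolate the adjacent letters `i, i - 1`. The appended `i` commutes with
  -- the smaller letters on their right, the braid relation turns `i, i - 1, i` into `i - 1, i, i -
  -- 1`, and the leading `i - 1` commutes with the larger letters on the left.
  have e : (List.range' b (p + 2 + q)).reverse =
      (List.range' (b + p + 2) q).reverse ++ ([b + p + 1, b + p] ++ (List.range' b p).reverse) := by
    rw [add_assoc p, ← List.range'_append_1, ← List.range'_append_1]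
    simp [List.range'_succ, add_assoc]
  rw [e]
  have hl : LeadEq g t ((List.range' b p).reverse ++ [b + p + 1])
      ((b + p + 1) :: (List.range' b p).reverse) :=
    append_singleton_comm hg ht (by omega) fun x hx => by
      simp [List.mem_range'_1] at hx; omega
  have hr : LeadEq g t ((List.range' (b + p + 2) q).reverse ++ [b + p])
      ((b + p) :: (List.range' (b + p + 2) q).reverse) :=
    append_singleton_comm hg ht (by omega) fun x hx => by
      simp [List.mem_range'_1] at hx; omega
  have h1 := hl.append_left ((List.range' (b + p + 2) q).reverse ++ [b + p + 1, b + p])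
  have h2 := (braid hg ht h₁ (by omega)).symm.congr (List.range' (b + p + 2) q).reverse
    (List.range' b p).reverse
  have h3 := hr.append_right ([b + p + 1, b + p] ++ (List.range' b p).reverse)
  simp only [List.append_assoc, List.cons_append, List.nil_append] at h1 h2 h3 ⊢
  exact h1.trans (h2.trans h3)

/-- `s_b ⋯ s_m s_i = s_{i+1} s_b ⋯ s_m` for `b ≤ i < m`, with `i = b + p`. -/
theorem range'_append {b p q : ℕ} (h₁ : 1 ≤ b + p) (h : b + p + 2 + q ≤ n) :
    LeadEq g t (List.range' b (p + 2 + q) ++ [b + p])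
      ((b + p + 1) :: List.range' b (p + 2 + q)) := by
  have e : List.range' b (p + 2 + q) =
      List.range' b p ++ ([b + p, b + p + 1] ++ List.range' (b + p + 2) q) := by
    rw [add_assoc p, ← List.range'_append_1, ← List.range'_append_1]
    simp [List.range'_succ, add_assoc]
  rw [e]
  have hl : LeadEq g t (List.range' (b + p + 2) q ++ [b + p])
      ((b + p) :: List.range' (b + p + 2) q) :=
    append_singleton_comm hg ht (by omega) fun x hx => by
      simp [List.mem_range'_1] at hx; omega
  have hr : LeadEq g t (List.range' b p ++ [b + p + 1]) ((b + p + 1) :: List.range' b p) :=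
    append_singleton_comm hg ht (by omega) fun x hx => by
      simp [List.mem_range'_1] at hx; omega
  have h1 := hl.append_left (List.range' b p ++ [b + p, b + p + 1])
  have h2 := (braid hg ht h₁ (by omega)).congr (List.range' b p) (List.range' (b + p + 2) q)
  have h3 := hr.append_right ([b + p, b + p + 1] ++ List.range' (b + p + 2) q)
  simp only [List.append_assoc, List.cons_append, List.nil_append] at h1 h2 h3 ⊢
  exact h1.trans (h2.trans h3)

end LeadEq

/-- The word made of the first `j` indices of `m, m - 1, …, 1, 0, 1, …, m`. -/
def descentWord (m j : ℕ) : List ℕ := (List.range j).map fun t : ℕ => ((m : ℤ) - (t : ℤ)).natAbs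

theorem descentWord_succ (m j : ℕ) :
    descentWord m (j + 1) = descentWord m j ++ [((m : ℤ) - (j : ℤ)).natAbs] := by
  simp [descentWord, List.range_succ]

theorem descentWord_of_le {m j : ℕ} (h : j ≤ m + 1) :
    descentWord m j = (List.range' (m + 1 - j) j).reverse := by
  apply List.ext_getElem
  · simp [descentWord]
  · intro i h1 h2
    simp [descentWord] at h1 h2 ⊢
    omega

theorem descentWord_add (m j : ℕ) :
    descentWord m (m + 1 + j) = (List.range' 0 (m + 1)).reverse ++ List.range' 1 j := by
  induction j with
  | zero => rw [add_zero, descentWord_of_le le_rfl]; simp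
  | succ j ih =>
    have e : ((m : ℤ) - ((m + 1 + j : ℕ) : ℤ)).natAbs = 1 + 1 * j := by push_cast; omega
    rw [← add_assoc, descentWord_succ, ih, List.range'_concat (s := 1), List.append_assoc, e]

/-! ### Right multiplication of a normal form by one letter. -/

section
variable (hg : FilteredTypeB n g) (ht : CoxeterTypeB n t)
include hg ht

/-- Moving a letter, other than the next or the last one, through `s_m ⋯ s_b`. -/
theorem descentWord_append_of_le {m j i : ℕ} (hm : m < n) (hi : i ≤ m) (hj : j ≤ m)
    (h1 : i + j ≠ m) (h2 : i + j ≠ m + 1) :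
    ∃ i' < m, LeadEq g t (descentWord m j ++ [i]) (i' :: descentWord m j) := by
  rw [descentWord_of_le (by omega)]
  rcases lt_or_gt_of_ne h1 with h | h
  · exact ⟨i, by omega, .append_singleton_comm hg ht (by omega) fun x hx => by
      simp [List.mem_range'_1] at hx; omega⟩
  · have e := LeadEq.reverse_range'_append hg ht (b := m + 1 - j) (p := i + j - m - 2) (q := m - i)
      (by omega) (by omega)
    rw [show i + j - m - 2 + 2 + (m - i) = j by omega,
      show m + 1 - j + (i + j - m - 2) + 1 = i by omega] at e
    exact ⟨_, by omega, e⟩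

/-- Moving a letter, other than the next or the last one, through `s_m ⋯ s_1 s_0 s_1 ⋯ s_j`. -/
theorem descentWord_add_append {m j i : ℕ} (hm : m < n) (hi : i ≤ m) (hj : j ≤ m)
    (h1 : i ≠ j) (h2 : i ≠ j + 1) :
    ∃ i' < m, LeadEq g t (descentWord m (m + 1 + j) ++ [i]) (i' :: descentWord m (m + 1 + j)) := by
  rw [descentWord_add, List.append_assoc]
  have key : ∀ i, 2 ≤ i → i ≤ m → LeadEq g t ((List.range' 0 (m + 1)).reverse ++ [i])
      ((i - 1) :: (List.range' 0 (m + 1)).reverse) := fun i h2 hi => by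
    have e := LeadEq.reverse_range'_append hg ht (b := 0) (p := i - 1) (q := m - i)
      (by omega) (by omega)
    rwa [show i - 1 + 2 + (m - i) = m + 1 by omega, show 0 + (i - 1) + 1 = i by omega,
      zero_add] at e
  -- A letter `i ≥ j + 2` passes the ascending part unchanged and leaves the descending part as `i -
  -- 1`. A letter `1 ≤ i < j` becomes `i + 1` in the ascending part and `i` again in the descending
  -- one. For `i = 0` the word contains `1, 0, 1, 0` after commutations, and the braid relation of
  -- length four releases a `0` on the left.
  rcases lt_or_gt_of_ne h2 with h | h
  · rcases Nat.eq_zero_or_pos i with rfl | h0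
    · obtain ⟨j, rfl⟩ : ∃ j', j = j' + 1 := ⟨j - 1, by omega⟩
      obtain ⟨m, rfl⟩ : ∃ m', m = m' + 1 := ⟨m - 1, by omega⟩
      refine ⟨0, by omega, ?_⟩
      have eU : List.range' 1 (j + 1) = 1 :: List.range' 2 j := by simp [List.range'_succ]
      have eD : (List.range' 0 (m + 1 + 1)).reverse = (List.range' 2 m).reverse ++ [1, 0] := by
        simp [List.range'_succ]
      rw [eU, eD]
      have a1 : LeadEq g t (List.range' 2 j ++ [0]) (0 :: List.range' 2 j) :=
        .append_singleton_comm hg ht (by omega) fun x hx => by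
          simp [List.mem_range'_1] at hx; omega
      have a2 : LeadEq g t ((List.range' 2 m).reverse ++ [0]) (0 :: (List.range' 2 m).reverse) :=
        .append_singleton_comm hg ht (by omega) fun x hx => by
          simp [List.mem_range'_1] at hx; omega
      have b1 := a1.append_left ((List.range' 2 m).reverse ++ [1, 0, 1])
      have b2 := (LeadEq.braid_zero hg ht (by omega)).congr (List.range' 2 m).reverse
        (List.range' 2 j)
      have b3 := a2.append_right ([1, 0, 1] ++ List.range' 2 j)
      simp only [List.append_assoc, List.cons_append, List.nil_append] at b1 b2 b3 ⊢
      exact b1.trans (b2.trans b3)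
    · have e := LeadEq.range'_append hg ht (b := 1) (p := i - 1) (q := j - i - 1)
        (by omega) (by omega)
      rw [show i - 1 + 2 + (j - i - 1) = j by omega, show 1 + (i - 1) = i by omega] at e
      refine ⟨i, by omega, (e.append_left _).trans ?_⟩
      simpa using (key (i + 1) (by omega) (by omega)).append_right (List.range' 1 j)
  · have e : LeadEq g t (List.range' 1 j ++ [i]) (i :: List.range' 1 j) :=
      .append_singleton_comm hg ht (by omega) fun x hx => by
        simp [List.mem_range'_1] at hx; omega
    refine ⟨i - 1, by omega, (e.append_left _).trans ?_⟩
    simpa using (key i (by omega) (by omega)).append_right (List.range' 1 j)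

/-- The next letter of the sequence lengthens the factor. A repeated last letter cancels, except
that `0, 0` is degenerate. Any other letter crosses to the left and emerges with index below `m`,
where the earlier factors can absorb it. -/
theorem descentWord_append {m j i : ℕ} (hm : m < n) (hi : i ≤ m) (hj : j < 2 * m + 2) :
    Degenerate g t (descentWord m j ++ [i]) ∨
    (∃ j' < 2 * m + 2, LeadEq g t (descentWord m j ++ [i]) (descentWord m j')) ∨
    ∃ i' < m, LeadEq g t (descentWord m j ++ [i]) (i' :: descentWord m j) := by
  by_cases hnext : ((m : ℤ) - (j : ℤ)).natAbs = i ∧ j < 2 * m + 1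
  · exact .inr (.inl ⟨j + 1, by omega, .of_eq (by rw [descentWord_succ, hnext.1])⟩)
  by_cases hlast : ∃ j', j = j' + 1 ∧ ((m : ℤ) - (j' : ℤ)).natAbs = i
  · obtain ⟨j, rfl, e⟩ := hlast
    rw [descentWord_succ, e, List.append_assoc]
    rcases Nat.eq_zero_or_pos i with rfl | h0
    · left
      have h : Degenerate g t [0, 0] :=
        ⟨by simpa [zeros_cons] using hg.sq_zero (by omega),
          [], by simp [ht.sq 0 (by omega)], by simp [zeros_cons]⟩
      simpa using h.congr (descentWord m j) []
    · exact .inr (.inl ⟨j, by omega, by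
        simpa using (LeadEq.sq hg ht h0 (by omega)).append_left (descentWord m j)⟩)
  refine .inr (.inr ?_)
  rcases le_or_gt j (m + 1) with h | h
  -- A factor ending exactly at `0` is the case of an empty ascending part.
  · by_cases h1 : j = m + 1
    · subst h1
      refine descentWord_add_append hg ht (j := 0) hm hi (by omega) ?_ ?_
      · rintro rfl
        exact hlast ⟨m, rfl, by simp⟩
      · rintro rfl
        exact hnext (by omega)
    · refine descentWord_append_of_le hg ht hm hi (by omega) ?_ ?_
      · intro h3
        exact hnext (by omega)
      · intro h3
        exact hlast ⟨j - 1, by omega, by omega⟩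
  · obtain ⟨j, rfl⟩ : ∃ j', j = m + 1 + j' := ⟨j - m - 1, by omega⟩
    refine descentWord_add_append hg ht hm hi (by omega) ?_ ?_
    · intro h3
      exact hlast ⟨m + j, by omega, by omega⟩
    · intro h3
      exact hnext (by omega)

/-- Every word is degenerate or agrees to leading order with a normal form. -/
theorem degenerate_or_leadEq_normalForm (N : ℕ) (hN : N ≤ n) (l : List ℕ) (hl : ∀ i ∈ l, i < N) :
    Degenerate g t l ∨ ∃ c : ℕ → ℕ, (∀ m < N, c m < 2 * m + 2) ∧
      LeadEq g t l ((List.range N).flatMap fun m => descentWord m (c m)) := by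
  induction N generalizing l with
  | zero =>
    have : l = [] := List.eq_nil_iff_forall_not_mem.mpr fun i hi => absurd (hl i hi) (by omega)
    exact .inr ⟨0, by simp, .of_eq (by simp [this])⟩
  | succ m ih =>
    -- Once the prefix uses only letters below `m`, the induction hypothesis normalizes it without
    -- touching the last factor.
    have key : ∀ (l' : List ℕ) (j : ℕ), (∀ i ∈ l', i < m) → j < 2 * m + 2 →
        Degenerate g t (l' ++ descentWord m j) ∨ ∃ c : ℕ → ℕ, (∀ p < m + 1, c p < 2 * p + 2) ∧
          LeadEq g t (l' ++ descentWord m j)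
            ((List.range (m + 1)).flatMap fun m => descentWord m (c m)) := by
      intro l' j hl' hj
      rcases ih (by omega) l' hl' with h | ⟨c, hc, h⟩
      · exact .inl (h.congr [] _)
      · refine .inr ⟨Function.update c m j, fun p hp => ?_, ?_⟩
        · rcases eq_or_ne p m with rfl | hne
          · simpa using hj
          · rw [Function.update_of_ne hne]
            exact hc p (by omega)
        · rw [List.range_succ, List.flatMap_append]
          refine (h.append_right _).trans (.of_eq ?_)
          congr 1
          · refine List.flatMap_congr fun p hp => ?_
            rw [Function.update_of_ne (List.mem_range.mp hp).ne]
          · simp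
    induction l using List.reverseRecOn with
    | nil => simpa [descentWord] using key [] 0 (by simp) (by omega)
    | append_singleton l i ihl =>
      have hi : i ≤ m := Nat.lt_succ_iff.mp (hl i (by simp))
      rcases ihl fun x hx => hl x (by simp [hx]) with h | ⟨c, hc, h⟩
      · exact .inl (h.congr [] _)
      have e := h.append_right [i]
      rw [List.range_succ, List.flatMap_append, List.flatMap_singleton, List.append_assoc] at e
      have hmem : ∀ x ∈ (List.range m).flatMap fun m => descentWord m (c m), x < m := by
        intro x hx
        obtain ⟨p, hp, hx⟩ := List.mem_flatMap.mp hx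
        obtain ⟨s, hs, rfl⟩ := List.mem_map.mp hx
        have := hc p (by have := List.mem_range.mp hp; omega)
        rw [List.mem_range] at hp hs
        omega
      rcases descentWord_append hg ht (by omega) hi (hc m (by omega)) with h' | ⟨j', hj', h'⟩ |
        ⟨i', hi', h'⟩
      · exact .inl (Degenerate.of_leadEq (by simpa using h'.congr _ []) e)
      · have e := e.trans (h'.append_left _)
        rcases key _ j' hmem hj' with hk | ⟨c', hc', hk⟩
        · exact .inl (hk.of_leadEq e)
        · exact .inr ⟨c', hc', e.trans hk⟩
      · have e := e.trans (h'.append_left _)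
        rw [List.append_cons _ i'] at e
        rcases key (((List.range m).flatMap fun m => descentWord m (c m)) ++ [i']) (c m)
          (by
            intro x hx
            rcases List.mem_append.mp hx with hx | hx
            · exact hmem x hx
            · rw [List.mem_singleton.mp hx]; exact hi') (hc m (by omega)) with hk | ⟨c', hc', hk⟩
        · exact .inl (hk.of_leadEq e)
        · exact .inr ⟨c', hc', e.trans hk⟩

end

end Words

end FusedHecke

namespace FusedHecke

/-! ### Signs and barred values of signed permutations -/

section SignedPermutations

variable {n : ℕ}

theorem tau_fst (i : Fin n) (p : Letter n) : ((τ i).1 p).1.val =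
    if p.1.val + 1 = i.val then i.val else if p.1.val = i.val ∧ i.val ≠ 0 then i.val - 1
      else p.1.val := by
  obtain ⟨a, ε⟩ := p
  by_cases hi : i.val = 0
  · by_cases ha : a = i
    · subst ha; rw [tau_apply_zero _ hi]; simp [hi]
    · rw [tau_apply_of_lt i a (by rw [Fin.lt_def]; have := Fin.val_ne_iff.mpr ha; omega)]
      simp [hi]
  · unfold τ
    rw [if_neg hi]
    simp only [Equiv.prodCongr_apply, Prod.map_apply, Equiv.swap_apply_def, Fin.ext_iff]
    split_ifs <;> (try simp) <;> omega

theorem tau_snd (i : Fin n) (p : Letter n) : ((τ i).1 p).2 =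
    if p.1.val = 0 ∧ i.val = 0 then -p.2 else p.2 := by
  obtain ⟨a, ε⟩ := p
  by_cases hi : i.val = 0
  · by_cases ha : a = i
    · subst ha; rw [tau_apply_zero _ hi]; simp [hi]
    · have := Fin.val_ne_iff.mpr ha
      rw [tau_apply_of_lt i a (by rw [Fin.lt_def]; omega)]
      simp [show ¬ a.val = 0 by omega]
  · unfold τ
    simp [hi]

/-- The generators of `B n`, indexed by natural numbers. -/
def tauNat (n i : ℕ) : B n := if h : i < n then τ ⟨i, h⟩ else 1

theorem tauNat_of_lt {i : ℕ} (h : i < n) : tauNat n i = τ ⟨i, h⟩ := dif_pos h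

theorem B_ext {u v : B n} (h₁ : ∀ p, (u.1 p).1.val = (v.1 p).1.val)
    (h₂ : ∀ p, (u.1 p).2 = (v.1 p).2) : u = v :=
  Subtype.ext (Equiv.ext fun p => Prod.ext (Fin.ext (h₁ p)) (h₂ p))

theorem mul_apply (u v : B n) (p : Letter n) : (u * v).1 p = u.1 (v.1 p) := rfl

theorem one_apply (p : Letter n) : (1 : B n).1 p = p := rfl

theorem B_apply (ω : B n) (a : Fin n) (ε : ℤˣ) :
    ω.1 (a, ε) = ((ω.1 (a, 1)).1, ε * (ω.1 (a, 1)).2) := by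
  rcases Int.units_eq_one_or ε with rfl | rfl
  · simp
  · rw [ω.2 a 1]; simp

/-- The sign with which the absolute value `m` occurs in the word of `ω`. -/
def sgn (ω : B n) (m : Fin n) : ℤˣ := (ω⁻¹.1 (m, 1)).2

/-- The absolute values of the barred letters of `ω`. -/
def barredValues (ω : B n) : Finset (Fin n) := Finset.univ.filter fun m => sgn ω m = -1

@[simp] theorem mem_barredValues {ω : B n} {m : Fin n} : m ∈ barredValues ω ↔ sgn ω m = -1 := by
  simp [barredValues]

/-- The number of barred letters of `ω`. -/
def bars (ω : B n) : ℕ := (barredValues ω).card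

/-- The permutation of the absolute values given by `ω`. -/
def absPerm (ω : B n) : Equiv.Perm (Fin n) where
  toFun a := (ω.1 (a, 1)).1
  invFun a := (ω⁻¹.1 (a, 1)).1
  left_inv a := by
    have h : ω⁻¹.1 (ω.1 (a, 1)) = (a, 1) := ω.1.symm_apply_apply _
    have e : ω.1 (a, 1) = ((ω.1 (a, 1)).1, (ω.1 (a, 1)).2) := rfl
    rw [e, B_apply ω⁻¹] at h
    exact congrArg Prod.fst h
  right_inv a := by
    have h : ω.1 (ω⁻¹.1 (a, 1)) = (a, 1) := ω.1.apply_symm_apply _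
    have e : ω⁻¹.1 (a, 1) = ((ω⁻¹.1 (a, 1)).1, (ω⁻¹.1 (a, 1)).2) := rfl
    rw [e, B_apply ω] at h
    exact congrArg Prod.fst h

theorem sgn_mul (u v : B n) (m : Fin n) : sgn (u * v) m = sgn u m * sgn v ((absPerm u).symm m) := by
  unfold sgn
  rw [mul_inv_rev, mul_apply]
  have e : u⁻¹.1 (m, 1) = ((u⁻¹.1 (m, 1)).1, (u⁻¹.1 (m, 1)).2) := rfl
  rw [e, B_apply v⁻¹]
  rfl

/-- Signs multiply, so a barred value of `u * v` is barred in `u` or is the image under `u` of a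
value barred in `v`. -/
theorem bars_mul_le (u v : B n) : bars (u * v) ≤ bars u + bars v := by
  have : barredValues (u * v) ⊆ barredValues u ∪ (barredValues v).map (absPerm u).toEmbedding := by
    intro m
    simp only [mem_barredValues, Finset.mem_union, Finset.mem_map_equiv, sgn_mul]
    rcases Int.units_eq_one_or (sgn u m) with h | h <;> simp [h]
  refine (Finset.card_le_card this).trans ((Finset.card_union_le _ _).trans ?_)
  rw [Finset.card_map]
  rfl

theorem sgn_absPerm (ω : B n) (a : Fin n) : sgn ω (absPerm ω a) = (ω.1 (a, 1)).2 := by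
  have h : ω⁻¹.1 (ω.1 (a, 1)) = (a, 1) := ω.1.symm_apply_apply _
  have e : ω.1 (a, 1) = ((ω.1 (a, 1)).1, (ω.1 (a, 1)).2) := rfl
  rw [e, B_apply ω⁻¹] at h
  have h2 := congrArg Prod.snd h
  simp only at h2
  change _ * sgn ω (absPerm ω a) = 1 at h2
  rwa [mul_eq_one_iff_eq_inv, Int.units_inv_eq_self, eq_comm] at h2

theorem card_isBarred (ω : B n) : (Finset.univ.filter (IsBarred ω)).card = bars ω := by
  rw [← Finset.card_map (absPerm ω).toEmbedding]
  congr 1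
  ext m
  rw [Finset.mem_map_equiv, mem_barredValues, Finset.mem_filter]
  simp only [Finset.mem_univ, true_and, IsBarred, ← sgn_absPerm, Equiv.apply_symm_apply]

/-- The signed permutation without bars given by a permutation. -/
def ofPerm (π : Equiv.Perm (Fin n)) : B n :=
  ⟨Equiv.prodCongr π (Equiv.refl ℤˣ), fun _ _ => rfl⟩

theorem ofPerm_apply (π : Equiv.Perm (Fin n)) (p : Letter n) : (ofPerm π).1 p = (π p.1, p.2) := rfl

theorem ofPerm_mul (π ρ : Equiv.Perm (Fin n)) : ofPerm (π * ρ) = ofPerm π * ofPerm ρ := rfl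

theorem ofPerm_inv (π : Equiv.Perm (Fin n)) : ofPerm π⁻¹ = (ofPerm π)⁻¹ := rfl

theorem absPerm_ofPerm (π : Equiv.Perm (Fin n)) : absPerm (ofPerm π) = π := rfl

@[simp] theorem sgn_ofPerm (π : Equiv.Perm (Fin n)) (m : Fin n) : sgn (ofPerm π) m = 1 := rfl

theorem bars_ofPerm (π : Equiv.Perm (Fin n)) : bars (ofPerm π) = 0 := by
  simp [bars, barredValues]

/-- The signed permutation that changes the signs of the elements of `J`. -/
def flip (J : Finset (Fin n)) : B n :=
  ⟨Function.Involutive.toPerm (fun p : Letter n => (p.1, if p.1 ∈ J then -p.2 else p.2))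
    (fun p => by by_cases h : p.1 ∈ J <;> simp [h]), fun a ε => Prod.ext rfl (by
      change (if a ∈ J then - -ε else -ε) = -(if a ∈ J then -ε else ε)
      split_ifs <;> rfl)⟩

theorem flip_apply (J : Finset (Fin n)) (p : Letter n) :
    (flip J).1 p = (p.1, if p.1 ∈ J then -p.2 else p.2) := rfl

theorem flip_mul_flip (J : Finset (Fin n)) : flip J * flip J = 1 := by
  refine B_ext (fun p => rfl) fun p => ?_
  rw [mul_apply, flip_apply, flip_apply]
  by_cases h : p.1 ∈ J <;> simp [h]

theorem sgn_flip (J : Finset (Fin n)) (m : Fin n) : sgn (flip J) m = if m ∈ J then -1 else 1 := rfl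

theorem absPerm_flip (J : Finset (Fin n)) : absPerm (flip J) = 1 := rfl

theorem barredValues_flip (J : Finset (Fin n)) : barredValues (flip J) = J := by
  ext m
  rw [mem_barredValues, sgn_flip]
  split_ifs with h <;> simp [h]

theorem bars_flip (J : Finset (Fin n)) : bars (flip J) = J.card := by
  rw [bars, barredValues_flip]

/-- A set of barred values can be split off. -/
theorem exists_eq_ofPerm_mul_flip_mul (ω : B n) (π : Equiv.Perm (Fin n)) (J : Finset (Fin n))
    (h : ∀ j ∈ J, π j ∈ barredValues ω) :
    ∃ v, ω = ofPerm π * flip J * v ∧ bars v + J.card = bars ω := by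
  refine ⟨flip J * ((ofPerm π)⁻¹ * ω), ?_, ?_⟩
  · rw [mul_assoc, ← mul_assoc (flip J), flip_mul_flip, one_mul, mul_inv_cancel_left]
  -- The inverse of `π` carries the barred values of `ω` to a set containing `J`, and the flip then
  -- removes exactly the bars on `J`.
  · have e : barredValues (flip J * ((ofPerm π)⁻¹ * ω)) =
        (barredValues ω).map π.symm.toEmbedding \ J := by
      ext m
      rw [mem_barredValues, sgn_mul, sgn_flip, ← ofPerm_inv, absPerm_flip, sgn_mul, sgn_ofPerm,
        absPerm_ofPerm, Finset.mem_sdiff, Finset.mem_map_equiv, mem_barredValues]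
      change _ * (1 * sgn ω (π m)) = -1 ↔ sgn ω (π m) = -1 ∧ m ∉ J
      split_ifs with hm
      · have := mem_barredValues.mp (h m hm)
        simp [this, hm]
      · simp [hm]
    have hJ : J ⊆ (barredValues ω).map π.symm.toEmbedding := fun j hj => by
      rw [Finset.mem_map_equiv]; exact h j hj
    rw [bars, e, Finset.card_sdiff_add_card_eq_card hJ, Finset.card_map, bars]

theorem exists_perm_of_card_le {J I : Finset (Fin n)} (h : J.card ≤ I.card) :
    ∃ π : Equiv.Perm (Fin n), ∀ j ∈ J, π j ∈ I := by
  obtain ⟨I', hI', hc⟩ := Finset.exists_subset_card_eq h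
  let e : {x // x ∈ J} ≃ {x // x ∈ I'} := Finset.equivOfCardEq hc.symm
  refine ⟨e.extendSubtype, fun j hj => hI' (e.extendSubtype_mem j hj)⟩

theorem tauNat_eq_ofPerm {i : ℕ} (h : i + 1 < n) :
    tauNat n (i + 1) = ofPerm (Equiv.swap ⟨i, by omega⟩ ⟨i + 1, h⟩) := by
  rw [tauNat_of_lt h, τ, if_neg (by simp)]
  rfl

theorem coxeterTypeB_tauNat : CoxeterTypeB n (tauNat n) where
  sq i h := by
    rw [tauNat_of_lt h]
    refine B_ext (fun p => ?_) fun p => ?_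
    · simp only [mul_apply, tau_fst, one_apply]; split_ifs <;> omega
    · simp only [mul_apply, tau_fst, tau_snd, one_apply]; split_ifs <;> first | omega | simp
  comm i j hij h := by
    rw [tauNat_of_lt h, tauNat_of_lt (by omega)]
    refine B_ext (fun p => ?_) fun p => ?_
    · simp only [mul_apply, tau_fst]; split_ifs <;> omega
    · simp only [mul_apply, tau_fst, tau_snd]; split_ifs <;> first | omega | simp
  braid i h₁ h := by
    obtain ⟨i, rfl⟩ : ∃ i', i = i' + 1 := ⟨i - 1, by omega⟩
    rw [tauNat_eq_ofPerm h, tauNat_eq_ofPerm (by omega)]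
    let a : Fin n := ⟨i, by omega⟩
    let b : Fin n := ⟨i + 1, by omega⟩
    let c : Fin n := ⟨i + 1 + 1, h⟩
    have hab : a ≠ b := by simp [a, b]
    have hac : a ≠ c := by simp [a, c]; omega
    have hbc : b ≠ c := by simp [b, c]
    -- Both sides of the braid relation are the transposition of `a` and `c`.
    have h1 := Equiv.swap_mul_swap_mul_swap hab hac
    have h2 := Equiv.swap_mul_swap_mul_swap hbc.symm hac.symm
    rw [Equiv.swap_comm b a, Equiv.swap_comm c b, Equiv.swap_comm a c] at h2
    exact congrArg ofPerm (h2.trans h1.symm)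
  braid_zero h := by
    rw [tauNat_of_lt h, tauNat_of_lt (by omega)]
    refine B_ext (fun p => ?_) fun p => ?_ <;>
    · have hp : p.1.val = 0 ∨ p.1.val = 1 ∨ p.1.val ≠ 0 ∧ p.1.val ≠ 1 := by omega
      rcases hp with hp | hp | hp <;> simp [tau_fst, tau_snd, hp]

theorem tauNat_zero (h : 0 < n) : tauNat n 0 = flip {⟨0, h⟩} := by
  rw [tauNat_of_lt h]
  refine B_ext (fun p => ?_) fun p => ?_
  · rw [tau_fst, flip_apply]; simp
  · rw [tau_snd, flip_apply]; simp [Fin.ext_iff]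

/-- This is the longest element of `B_2`; it links the leading term of `(x_1 s_1)²` to a pair of
barred values. -/
theorem wordProd_tauNat_eq_flip (h : 1 < n) :
    wordProd (tauNat n) [0, 1, 0, 1] = flip {⟨0, by omega⟩, ⟨1, h⟩} := by
  simp only [wordProd_cons, wordProd_nil, tauNat_of_lt h, tauNat_of_lt (show 0 < n by omega)]
  refine B_ext (fun p => ?_) fun p => ?_ <;>
  · have hp : p.1.val = 0 ∨ p.1.val = 1 ∨ p.1.val ≠ 0 ∧ p.1.val ≠ 1 := by omega
    rcases hp with hp | hp | hp <;> simp [tau_fst, tau_snd, flip_apply, Fin.ext_iff, hp]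

theorem bars_tauNat_le (i : ℕ) : bars (tauNat n i) ≤ zeros [i] := by
  by_cases h : i < n
  · rcases Nat.eq_zero_or_pos i with rfl | h0
    · rw [tauNat_zero h, bars_flip]; simp [zeros_cons]
    · obtain ⟨i, rfl⟩ : ∃ i', i = i' + 1 := ⟨i - 1, by omega⟩
      rw [tauNat_eq_ofPerm h, bars_ofPerm]; omega
  · rw [tauNat, dif_neg h, show (1 : B n) = ofPerm 1 from rfl, bars_ofPerm]; omega

/-- Only `τ_0` has a bar, and it has one. Hence a degenerate word represents an element with fewer
bars than the word has letters `0`. -/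
theorem bars_wordProd_le (l : List ℕ) : bars (wordProd (tauNat n) l) ≤ zeros l := by
  induction l with
  | nil => rw [wordProd_nil, show (1 : B n) = ofPerm 1 from rfl, bars_ofPerm]; omega
  | cons i l ih =>
    rw [wordProd_cons, ← List.singleton_append, zeros_append]
    exact (bars_mul_le _ _).trans (add_le_add (bars_tauNat_le i) ih)

end SignedPermutations

/-! ### Bars and normal forms -/

section NormalForms

variable {n : ℕ}

theorem map_val_factorWord (m : Fin n) (j : Fin (2 * m.val + 2)) :
    (factorWord m j).map Fin.val = descentWord m.val j.val := by
  apply List.ext_getElem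
  · simp [factorWord, descentWord]
  · intro i h1 h2
    simp [factorWord, descentWord]

/-- The word of a normal form, with natural numbers as letters. -/
def natWord (c : NormalForm n) : List ℕ := c.word.map Fin.val

theorem natWord_eq (c : NormalForm n) (d : ℕ → ℕ) (h : ∀ m : Fin n, (c m).val = d m.val) :
    natWord c = (List.range n).flatMap fun m => descentWord m (d m) := by
  rw [natWord, NormalForm.word, List.map_flatten, List.map_ofFn, List.flatMap,
    ← List.map_coe_finRange_eq_range, List.map_map, List.ofFn_eq_map]
  congr 1
  refine List.map_congr_left fun m _ => ?_
  simp [map_val_factorWord, h]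

theorem wordProd_map_val {M : Type*} [Monoid M] (g : ℕ → M) (l : List (Fin n)) :
    wordProd g (l.map Fin.val) = (l.map fun i => g i.val).prod := by
  rw [wordProd, List.map_map]; rfl

theorem wordProd_tauNat_natWord (c : NormalForm n) : wordProd (tauNat n) (natWord c) = c.toB := by
  rw [natWord, wordProd_map_val, NormalForm.toB]
  congr 2
  funext i
  exact tauNat_of_lt i.2

theorem zeros_descentWord (m j : ℕ) : zeros (descentWord m j) = if m < j then 1 else 0 := by
  induction j with
  | zero => simp [descentWord]
  | succ j ih =>
    rw [descentWord_succ, zeros_append, ih, zeros_cons, zeros_nil]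
    split_ifs <;> omega

theorem tau_source (m : Fin n) (j : ℕ) (hj : j + 1 < 2 * m.val + 2) :
    (τ (⟨((m.val : ℤ) - (j : ℤ)).natAbs, by omega⟩ : Fin n)).1 (source m ⟨j + 1, hj⟩) =
      source m ⟨j, by omega⟩ := by
  refine Prod.ext (Fin.ext ?_) ?_
  · rw [tau_fst]
    unfold source
    simp only
    split_ifs <;> simp_all <;> omega
  · rw [tau_snd]
    unfold source
    simp only
    split_ifs <;> simp_all <;> omega

/-- A sign changes only when the letter `0` of the word acts, which happens at most once, and the
entry it acts on is the one being carried to position `m`, that is, the source. -/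
theorem factorB_snd (m : Fin n) (j : ℕ) (hj : j < 2 * m.val + 2) (p : Letter n)
    (hp : p.1 ≠ (source m ⟨j, hj⟩).1) : ((factorB m ⟨j, hj⟩).1 p).2 = p.2 := by
  induction j generalizing p with
  | zero => simp [factorB, factorWord]
  | succ j ih =>
    have hlast : factorB m ⟨j + 1, hj⟩ = factorB m ⟨j, by omega⟩ *
        τ ⟨((m.val : ℤ) - (j : ℤ)).natAbs, by omega⟩ := by
      unfold factorB factorWord
      simp only
      rw [List.ofFn_succ_last]
      simp
    rw [hlast, mul_apply, ih]
    · rw [tau_snd, if_neg]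
      rintro ⟨h1, h2⟩
      refine hp (Fin.ext ?_)
      unfold source
      simp only at h2 ⊢
      split_ifs <;> simp <;> omega
    · intro h
      apply hp
      rw [← tau_source m j hj] at h
      exact (absPerm (τ (⟨((m.val : ℤ) - (j : ℤ)).natAbs, by omega⟩ : Fin n))).injective (by
        change ((τ _).1 (p.1, 1)).1 = ((τ _).1 ((source m ⟨j + 1, hj⟩).1, 1)).1
        rw [show p = (p.1, p.2) from rfl, B_apply] at h
        rw [show source m ⟨j + 1, hj⟩ =
          ((source m ⟨j + 1, hj⟩).1, (source m ⟨j + 1, hj⟩).2) from rfl,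
          B_apply _ _ (source m ⟨j + 1, hj⟩).2] at h
        exact h)

theorem factorB_inv_apply (m : Fin n) (j : Fin (2 * m.val + 2)) (p : Letter n) (hp : p.1 < m) :
    ((factorB m j)⁻¹.1 p).1 ≤ m ∧ ((factorB m j)⁻¹.1 p).2 = p.2 := by
  obtain ⟨q, rfl⟩ := (factorB m j).1.surjective p
  have e : (factorB m j)⁻¹.1 ((factorB m j).1 q) = q := (factorB m j).1.symm_apply_apply q
  rw [e]
  constructor
  · by_contra h
    rw [show q = (q.1, q.2) from rfl, factorB_apply_of_lt m j q.1 (not_le.mp h)] at hp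
    exact h hp.le
  · rw [factorB_snd m j j.2 q]
    intro h
    have hs := factorB_source m j j.2
    rw [show q = (q.1, q.2) from rfl, B_apply, h] at hp
    rw [show source m ⟨j, j.2⟩ = ((source m j).1, (source m j).2) from rfl, B_apply] at hs
    have := congrArg Prod.fst hs
    simp only at this hp
    exact absurd this hp.ne

/-- The sign of the value `m` depends on the `m`-th factor alone: earlier factors fix it, the
inverse of the `m`-th factor sends it to its source, and later factors do not change the sign of
what is then a smaller value. -/
theorem partialProd_inv_apply (c : NormalForm n) (m : Fin n) (p : ℕ) (hp : p < n + 1)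
    (h : m.val < p) :
    ((Fin.partialProd (fun m => factorB m (c m)) ⟨p, hp⟩)⁻¹.1 (m, 1)).1.val < p ∧
    ((Fin.partialProd (fun m => factorB m (c m)) ⟨p, hp⟩)⁻¹.1 (m, 1)).2 =
      (source m (c m)).2 := by
  induction p with
  | zero => omega
  | succ p ih =>
    have e := Fin.partialProd_succ (fun m => factorB m (c m)) ⟨p, by omega⟩
    simp only [Fin.succ_mk, Fin.castSucc_mk] at e
    rw [e, mul_inv_rev, mul_apply]
    rcases Nat.lt_succ_iff_lt_or_eq.mp h with hlt | heq
    · obtain ⟨h1, h2⟩ := ih (by omega) hlt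
      have := factorB_inv_apply ⟨p, by omega⟩ (c ⟨p, by omega⟩) _ (Fin.lt_def.mpr h1)
      exact ⟨Nat.lt_succ_of_le (Fin.le_def.mp this.1), this.2.trans h2⟩
    · have hm : m = ⟨p, by omega⟩ := Fin.ext heq
      have e1 : (Fin.partialProd (fun m => factorB m (c m)) ⟨p, by omega⟩)⁻¹.1 (m, 1) = (m, 1) :=
        (Equiv.Perm.inv_eq_iff_eq).mpr (partialProd_apply c p _ m (by omega) 1).symm
      have e2 : (factorB m (c m))⁻¹.1 (m, 1) = source m (c m) :=
        (Equiv.Perm.inv_eq_iff_eq).mpr (factorB_source m (c m) (c m).2).symm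
      rw [e1, ← hm, e2]
      refine ⟨?_, rfl⟩
      have := (c m).2
      unfold source
      split_ifs <;> simp only <;> omega

theorem sgn_toB (c : NormalForm n) (m : Fin n) : sgn c.toB m = (source m (c m)).2 := by
  have := (partialProd_inv_apply c m n (by omega) m.2).2
  rw [toB_eq]
  unfold Fin.partialProd at this
  simpa [List.take_of_length_le, sgn] using this

theorem sgn_eq_neg_one_iff (ω : B n) (m : Fin n) :
    sgn ω m = -1 ↔ m.val < (normalForm ω m).val := by
  conv_lhs => rw [← toB_normalForm ω, sgn_toB]
  have hne : (1 : ℤˣ) ≠ -1 := by decide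
  unfold source
  split_ifs with h
  · simp [h, hne]
  · simp; omega

theorem zeros_map_val_pos_iff (l : List (Fin n)) :
    0 < zeros (l.map Fin.val) ↔ ∃ t ∈ l, t.val = 0 := by
  unfold zeros
  rw [List.count_pos_iff, List.mem_map]

theorem occ_eq (ω : B n) (m : Fin n) : occ ω m = if sgn ω m = -1 then 1 else 0 := by
  unfold occ
  simp only [← zeros_map_val_pos_iff, map_val_factorWord, zeros_descentWord, sgn_eq_neg_one_iff]
  split_ifs <;> simp_all

/-- Each factor contains the letter `0` at most once, and does so exactly when the corresponding
value is barred. -/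
theorem zeros_natWord_normalForm (ω : B n) : zeros (natWord (normalForm ω)) = bars ω := by
  have h : ∀ L : List (Fin n), zeros ((L.map fun m => factorWord m (normalForm ω m)).flatten.map
      Fin.val) = (L.map fun m => if sgn ω m = -1 then 1 else 0).sum := fun L => by
    induction L with
    | nil => rfl
    | cons m L ih =>
      rw [List.map_cons, List.flatten_cons, List.map_append, zeros_append, ih, map_val_factorWord,
        zeros_descentWord, List.map_cons, List.sum_cons]
      simp only [sgn_eq_neg_one_iff]
  rw [natWord, NormalForm.word, List.ofFn_eq_map, h, ← List.ofFn_eq_map, List.sum_ofFn, bars,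
    barredValues, Finset.card_filter]

end NormalForms

end FusedHecke

namespace FusedHecke

/-! ### The elements attached to signed permutations -/

section Basis

variable {n : ℕ} {R : Type*} [Ring R] [Algebra ℂ R]

/-- The product attached to the normal form of a signed permutation. -/
noncomputable def basisElt (g : ℕ → R) (ω : B n) : R := wordProd g (natWord (normalForm ω))

variable {g : ℕ → R}

theorem basisElt_mem_low {ω : B n} {d : ℕ} (h : bars ω < d) : basisElt g ω ∈ low g d :=
  wordProd_mem_low (by rwa [zeros_natWord_normalForm])

theorem mul_mem_low_mul (u v : B n) {d e : ℕ} (he : bars u + d + bars v ≤ e) {a : R}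
    (ha : a ∈ low g d) : basisElt g u * a * basisElt g v ∈ low g e :=
  mul_wordProd_mem_low _ (by rwa [zeros_natWord_normalForm])
    (wordProd_mul_mem_low _ (by rw [zeros_natWord_normalForm]) ha)

theorem lt_of_mem_natWord {c : NormalForm n} {i : ℕ} (h : i ∈ natWord c) : i < n := by
  obtain ⟨j, _, rfl⟩ := List.mem_map.mp h
  exact j.2

theorem wordProd_tauNat_normalForm (ω : B n) :
    wordProd (tauNat n) (natWord (normalForm ω)) = ω := by
  rw [wordProd_tauNat_natWord, toB_normalForm]

theorem bars_le (ω : B n) : bars ω ≤ n :=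
  (Finset.card_le_univ (barredValues ω)).trans_eq (Fintype.card_fin n)

theorem bars_ofPerm_mul (π : Equiv.Perm (Fin n)) (ω : B n) : bars (ofPerm π * ω) = bars ω := by
  apply le_antisymm
  · simpa [bars_ofPerm] using bars_mul_le (ofPerm π) ω
  · have h := bars_mul_le (ofPerm π⁻¹) (ofPerm π * ω)
    rwa [bars_ofPerm, zero_add, ofPerm_inv, inv_mul_cancel_left] at h

theorem absPerm_mul (u v : B n) : absPerm (u * v) = absPerm u * absPerm v := by
  refine Equiv.ext fun a => ?_
  change (u.1 (v.1 (a, 1))).1 = (u.1 ((v.1 (a, 1)).1, 1)).1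
  rw [show v.1 (a, 1) = ((v.1 (a, 1)).1, (v.1 (a, 1)).2) from rfl, B_apply u]

theorem eq_ofPerm_of_sgn {ω : B n} (h : ∀ m, sgn ω m = 1) : ω = ofPerm (absPerm ω) := by
  refine Subtype.ext (Equiv.ext fun p => ?_)
  rw [show p = (p.1, p.2) from rfl, B_apply, ofPerm_apply, ← sgn_absPerm, h, mul_one]
  rfl

/-! ### Leading terms of words and of products. -/

section
variable (hg : FilteredTypeB n g)
include hg

/-- A word is degenerate exactly when its product has fewer bars than it has letters `0`. -/
theorem wordProd_reduce (l : List ℕ) (hl : ∀ i ∈ l, i < n) :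
    (bars (wordProd (tauNat n) l) < zeros l ∧ wordProd g l ∈ low g (zeros l)) ∨
    (bars (wordProd (tauNat n) l) = zeros l ∧
      wordProd g l - basisElt g (wordProd (tauNat n) l) ∈ low g (zeros l)) := by
  rcases degenerate_or_leadEq_normalForm hg coxeterTypeB_tauNat n le_rfl l hl with h | ⟨c, hc, h⟩
  · obtain ⟨l', e, hlt⟩ := h.2
    -- The same group element is written with fewer letters `0`, which bounds its bars.
    exact .inl ⟨by rw [← e]; exact (bars_wordProd_le l').trans_lt hlt, h.1⟩
  · let d : NormalForm n := fun m => ⟨c m, hc m m.2⟩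
    rw [← natWord_eq d c fun _ => rfl] at h
    have e := h.2
    rw [wordProd_tauNat_natWord] at e
    have hd : d = normalForm (wordProd (tauNat n) l) :=
      toB_injective n (by rw [toB_normalForm, e])
    right
    rw [hd] at h
    exact ⟨by rw [h.1, zeros_natWord_normalForm], h.3⟩

theorem wordProd_sub_basisElt_mem_low (l : List ℕ) (hl : ∀ i ∈ l, i < n) {ω : B n}
    (hω : wordProd (tauNat n) l = ω) (h : bars ω = zeros l) :
    wordProd g l - basisElt g ω ∈ low g (zeros l) := by
  subst hω
  rcases wordProd_reduce hg l hl with h' | h'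
  · omega
  · exact h'.2

/-- The span `low` allows letters `≥ n`; their image is `1`, so they are deleted before reduction. A
letter `0` can be lost this way only if `n = 0`. -/
theorem wordProd_mem_low_or (hone : ∀ i, n ≤ i → g i = 1) (l : List ℕ) :
    wordProd g l ∈ low g (zeros l) ∨
    ∃ ω : B n, bars ω = zeros l ∧ wordProd g l - basisElt g ω ∈ low g (zeros l) := by
  have e : wordProd g (l.filter (· < n)) = wordProd g l := by
    induction l with
    | nil => rfl
    | cons i l ih =>
      by_cases h : i < n
      · rw [List.filter_cons_of_pos (by simpa using h), wordProd_cons, wordProd_cons, ih]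
      · rw [List.filter_cons_of_neg (by simpa using h), wordProd_cons, ih,
          hone i (not_lt.mp h), one_mul]
  have hz : zeros (l.filter (· < n)) ≤ zeros l := List.filter_sublist.count_le 0
  rw [← e]
  rcases hz.lt_or_eq with h | h
  · exact .inl (wordProd_mem_low h)
  · rw [← h]
    rcases wordProd_reduce hg (l.filter (· < n)) (fun i hi => by simpa using List.of_mem_filter hi)
      with h' | h'
    · exact .inl h'.2
    · exact .inr ⟨_, h'⟩

/-- Degree `d` contributes, modulo lower degrees, only the elements attached to signed permutations
with exactly `d` bars. -/
theorem low_succ_le (hone : ∀ i, n ≤ i → g i = 1) {d : ℕ} {S : Submodule ℂ R} (hd : low g d ≤ S)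
    (h : ∀ ω : B n, bars ω = d → basisElt g ω ∈ S) : low g (d + 1) ≤ S := by
  refine low_le fun l hl => ?_
  rcases (Nat.lt_succ_iff.mp hl).lt_or_eq with hlt | rfl
  · exact hd (wordProd_mem_low hlt)
  · rcases wordProd_mem_low_or hg hone l with h' | ⟨ω, hω, h'⟩
    · exact hd h'
    · rw [← sub_add_cancel (wordProd g l) (basisElt g ω)]
      exact add_mem (hd h') (h ω hω)

/-- The elements attached to signed permutations multiply, to leading order, whenever the numbers
of bars add up. -/
theorem basisElt_mul_mul (u v w : B n) (h : bars (u * v * w) = bars u + bars v + bars w) :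
    basisElt g u * basisElt g v * basisElt g w - basisElt g (u * v * w) ∈
      low g (bars (u * v * w)) := by
  have key := wordProd_sub_basisElt_mem_low hg (natWord (normalForm u) ++ natWord (normalForm v) ++
    natWord (normalForm w)) (ω := u * v * w)
    (by
      intro i hi
      simp only [List.mem_append] at hi
      rcases hi with (hi | hi) | hi <;> exact lt_of_mem_natWord hi)
    (by simp only [wordProd_append, wordProd_tauNat_normalForm])
    (by simp only [zeros_append, zeros_natWord_normalForm, h])
  simp only [zeros_append, zeros_natWord_normalForm, wordProd_append] at key
  rwa [h]

/-! ### Consequences of the relation for `(x_1 s_1)²`, whose leading part is `hA`, and of `F̃_{k+1}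
= 0`. -/

variable (hA : 1 < n → wordProd g [0, 1, 0, 1] - wordProd g [0, 1, 0] ∈ low g 2)
include hA

/-- In an element that has two bars, the barred values can be exchanged. -/
theorem basisElt_sub_swap_mul_mem_low {ω : B n} {p q : Fin n} (hpq : p ≠ q)
    (hp : p ∈ barredValues ω) (hq : q ∈ barredValues ω) :
    basisElt g ω - basisElt g (ofPerm (Equiv.swap p q) * ω) ∈ low g (bars ω) := by
  have hn : 1 < n := by
    have := Fin.val_ne_iff.mpr hpq
    omega
  let z : Fin n := ⟨0, by omega⟩
  let o : Fin n := ⟨1, hn⟩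
  have hzo : z ≠ o := by simp [z, o]
  have hc : ({z, o} : Finset (Fin n)).card = 2 := Finset.card_pair hzo
  -- Transport the first two values to `p, q`, so that `ω = π f v` with `f` the flip of those two,
  -- and left multiplication of `ω` by the swap of `p` and `q` gives `π (s f) v`. It then suffices
  -- to compare `f` with `s f`.
  obtain ⟨π, hπ⟩ := exists_perm_of_card_le (J := {z, o}) (I := {p, q})
    (by rw [hc, Finset.card_pair hpq])
  have hz := hπ z (by simp)
  have ho := hπ o (by simp)
  have hne : π z ≠ π o := π.injective.ne hzo
  have hs : Equiv.swap p q = π * Equiv.swap z o * π⁻¹ := by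
    rw [← Equiv.swap_apply_apply]
    simp only [Finset.mem_insert, Finset.mem_singleton] at hz ho
    rcases hz with hz | hz <;> rcases ho with ho | ho
    · exact absurd (hz.trans ho.symm) hne
    · rw [hz, ho]
    · rw [hz, ho, Equiv.swap_comm]
    · exact absurd (hz.trans ho.symm) hne
  obtain ⟨v, hv, hb⟩ := exists_eq_ofPerm_mul_flip_mul ω π {z, o} (by
    have hsub : ({p, q} : Finset (Fin n)) ⊆ barredValues ω := by
      intro x hx
      simp only [Finset.mem_insert, Finset.mem_singleton] at hx
      rcases hx with rfl | rfl <;> assumption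
    exact fun j hj => hsub (hπ j hj))
  rw [hc] at hb
  set f : B n := flip {z, o} with hf
  set s : B n := ofPerm (Equiv.swap z o) with hsd
  have hs1 : tauNat n 1 = s := tauNat_eq_ofPerm hn
  have hss : s * s = 1 := by rw [hsd, ← ofPerm_mul, Equiv.swap_mul_self]; rfl
  have hw : wordProd (tauNat n) [0, 1, 0, 1] = f := wordProd_tauNat_eq_flip hn
  -- By the braid relation `f` is also `τ_1 τ_0 τ_1 τ_0`, and `s = τ_1` cancels its first letter.
  have hw' : wordProd (tauNat n) [0, 1, 0] = s * f := by
    have e := coxeterTypeB_tauNat.braid_zero hn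
    simp only [wordProd_cons, wordProd_nil, mul_one, ← mul_assoc] at hw ⊢
    rw [← hw, e, hs1]
    simp only [← mul_assoc, hss, one_mul]
  have hbf : bars f = 2 := by rw [hf, bars_flip, hc]
  have hbsf : bars (s * f) = 2 := by rw [hsd, bars_ofPerm_mul, hbf]
  have h1 := wordProd_sub_basisElt_mem_low hg [0, 1, 0, 1] (by simp; omega) hw
    (by simp [hbf, zeros_cons])
  have h2 := wordProd_sub_basisElt_mem_low hg [0, 1, 0] (by simp; omega) hw'
    (by simp [hbsf, zeros_cons])
  rw [show zeros [0, 1, 0, 1] = 2 from rfl] at h1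
  rw [show zeros [0, 1, 0] = 2 from rfl] at h2
  have h3 : basisElt g f - basisElt g (s * f) ∈ low g 2 := by
    have := add_mem (sub_mem (hA hn) h1) h2
    convert this using 1
    abel
  have e' : ofPerm (Equiv.swap p q) * ω = ofPerm π * (s * f) * v := by
    rw [hs, hv, ofPerm_mul, ofPerm_mul, ofPerm_inv]
    simp only [mul_assoc, inv_mul_cancel_left, ← hsd]
  have hbω' : bars (ofPerm π * (s * f) * v) = bars ω := by rw [← e', bars_ofPerm_mul]
  have h4 := basisElt_mul_mul hg (ofPerm π) f v (by
    rw [← hv, bars_ofPerm, hbf]; omega)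
  have h5 := basisElt_mul_mul hg (ofPerm π) (s * f) v (by
    rw [hbω', bars_ofPerm, hbsf]; omega)
  have h6 := mul_mem_low_mul (ofPerm π) v (e := bars ω) (by rw [bars_ofPerm]; omega) h3
  rw [← hv] at h4
  rw [hbω', ← e'] at h5
  convert add_mem (sub_mem h6 h4) h5 using 1
  noncomm_ring

/-- Such a `π` is a product of transpositions of barred values, and each of them preserves the set
of barred values, so the exchange can be iterated. -/
theorem basisElt_sub_perm_mul_mem_low {ω : B n} (π : Equiv.Perm (Fin n))
    (hπ : ∀ x, π x ≠ x → x ∈ barredValues ω) :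
    basisElt g ω - basisElt g (ofPerm π * ω) ∈ low g (bars ω) := by
  have h₁ : ∀ x, π x ∈ barredValues ω ↔ x ∈ barredValues ω := fun x => by
    by_cases h : π x = x
    · rw [h]
    · exact iff_of_true (hπ _ (π.injective.ne h)) (hπ x h)
  rw [← Equiv.Perm.ofSubtype_subtypePerm (f := π) h₁ hπ]
  generalize π.subtypePerm h₁ = ρ
  induction ρ using Equiv.Perm.swap_induction_on with
  | one => rw [map_one, show ofPerm 1 * ω = ω from one_mul ω, sub_self]; exact zero_mem _
  | swap_mul f x y hxy ih =>
    have hmem : ∀ x : {x // x ∈ barredValues ω}, x.1 ∈ barredValues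
        (ofPerm (Equiv.Perm.ofSubtype f) * ω) := fun x => by
      rw [mem_barredValues, sgn_mul, sgn_ofPerm, one_mul, absPerm_ofPerm, ← mem_barredValues]
      change (Equiv.Perm.ofSubtype f)⁻¹ x.1 ∈ _
      rw [← map_inv, Equiv.Perm.ofSubtype_apply_coe]
      exact (f⁻¹ x).2
    have h := basisElt_sub_swap_mul_mem_low hg hA (Subtype.coe_ne_coe.mpr hxy) (hmem x) (hmem y)
    rw [map_mul, Equiv.Perm.ofSubtype_swap_eq, ofPerm_mul, mul_assoc]
    rw [bars_ofPerm_mul] at h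
    convert add_mem ih h using 1
    abel

/-- To leading order, the barred letters can be put in decreasing order. -/
theorem exists_avoids_sub_mem_low (ω : B n) :
    ∃ ω' : B n, AvoidsBarOneTwo ω' ∧ bars ω' = bars ω ∧
      basisElt g ω - basisElt g ω' ∈ low g (bars ω) := by
  -- Exchanging the absolute values at two barred positions `a < b` where they increase lowers this
  -- sum by `(b - a)(|ω(b)| - |ω(a)|) > 0`.
  induction hμ : ∑ a : Fin n, a.val * (absPerm ω a).val using Nat.strong_induction_on
    generalizing ω with
  | _ μ ih =>
    by_cases hav : AvoidsBarOneTwo ω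
    · exact ⟨ω, hav, rfl, by rw [sub_self]; exact zero_mem _⟩
    unfold AvoidsBarOneTwo at hav
    push Not at hav
    obtain ⟨a, b, hab, ha, hb, hle⟩ := hav
    change absPerm ω a ≤ absPerm ω b at hle
    have hlt : absPerm ω a < absPerm ω b := hle.lt_of_ne ((absPerm ω).injective.ne hab.ne)
    have hp : absPerm ω a ∈ barredValues ω := by rw [mem_barredValues, sgn_absPerm]; exact ha
    have hq : absPerm ω b ∈ barredValues ω := by rw [mem_barredValues, sgn_absPerm]; exact hb
    set σ : Equiv.Perm (Fin n) := Equiv.swap (absPerm ω a) (absPerm ω b) with hσ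
    have hdec : ∑ x : Fin n, x.val * (absPerm (ofPerm σ * ω) x).val < μ := by
      rw [← hμ]
      change ∑ x : Fin n, x.val * (σ (absPerm ω x)).val < _
      zify
      rw [← sub_pos, ← Finset.sum_sub_distrib, Fintype.sum_eq_add a b hab.ne]
      · rw [hσ, Equiv.swap_apply_left, Equiv.swap_apply_right]
        have h1 : (a.val : ℤ) < b.val := by exact_mod_cast hab
        have h2 : ((absPerm ω a).val : ℤ) < (absPerm ω b).val := by exact_mod_cast hlt
        nlinarith
      · rintro x ⟨hxa, hxb⟩
        rw [hσ, Equiv.swap_apply_of_ne_of_ne ((absPerm ω).injective.ne hxa)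
          ((absPerm ω).injective.ne hxb), sub_self]
    obtain ⟨ω', h1, h2, h3⟩ := ih _ hdec (ofPerm σ * ω) rfl
    rw [bars_ofPerm_mul] at h2 h3
    refine ⟨ω', h1, h2, ?_⟩
    convert add_mem (basisElt_sub_swap_mul_mem_low hg hA hlt.ne hp hq) h3 using 1
    abel

theorem low_le_span_avoiding (hone : ∀ i, n ≤ i → g i = 1) (k d : ℕ) (hd : d ≤ k + 1) :
    low g d ≤ Submodule.span ℂ (basisElt g '' avoiding n k) := by
  induction d with
  | zero => exact low_le fun l hl => absurd hl (Nat.not_lt_zero _)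
  | succ d ih =>
    refine low_succ_le hg hone (ih (by omega)) fun ω hω => ?_
    obtain ⟨ω', h1, h2, h3⟩ := exists_avoids_sub_mem_low hg hA ω
    rw [← sub_add_cancel (basisElt g ω) (basisElt g ω')]
    refine add_mem (ih (by omega) (hω ▸ h3)) (Submodule.subset_span ⟨ω', ⟨h1, ?_⟩, rfl⟩)
    rw [card_isBarred]
    omega

/-- In the vanishing sum, modulo `low g (k + 1)`, a term without all of `J` barred disappears, and
every other one equals `basisElt g (flip J)`. What remains is a multiple of this element by the
number of such terms. -/
theorem basisElt_flip_mem_low {κ : ℂ} {k : ℕ}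
    (hF : ∑ ω : B n with ∀ a : Fin n, k + 1 ≤ a.val → ω.1 (a, 1) = (a, 1),
      (∏ i : Fin n with i.val < k + 1, ((i.val : ℂ) - κ) ^ (1 - occ ω i)) • basisElt g ω = 0)
    {J : Finset (Fin n)} (hJ : ∀ j, j ∈ J ↔ j.val < k + 1) (hJc : J.card = k + 1) :
    basisElt g (flip J) ∈ low g (k + 1) := by
  set F : Finset (B n) := Finset.univ.filter
    fun ω => ∀ a : Fin n, k + 1 ≤ a.val → ω.1 (a, 1) = (a, 1) with hFd
  have key : ∀ ω ∈ F, (∏ i : Fin n with i.val < k + 1, ((i.val : ℂ) - κ) ^ (1 - occ ω i)) •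
      basisElt g ω - (if J ⊆ barredValues ω then (1 : ℂ) else 0) • basisElt g (flip J) ∈
        low g (k + 1) := by
    intro ω hω
    have hfix : ∀ a : Fin n, a ∉ J → ω.1 (a, 1) = (a, 1) := fun a ha =>
      (Finset.mem_filter.mp hω).2 a (by rw [hJ] at ha; omega)
    have hfix' : ∀ a : Fin n, a ∉ J → absPerm ω a = a := fun a ha =>
      congrArg Prod.fst (hfix a ha)
    have hsub : barredValues ω ⊆ J := by
      intro m hm
      by_contra hmJ
      rw [mem_barredValues, ← hfix' m hmJ, sgn_absPerm, hfix m hmJ] at hm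
      exact absurd hm (show (1 : ℤˣ) ≠ -1 by decide)
    split_ifs with h
    · have hprod : (∏ i : Fin n with i.val < k + 1, ((i.val : ℂ) - κ) ^ (1 - occ ω i)) = 1 := by
        refine Finset.prod_eq_one fun i hi => ?_
        have hi' := mem_barredValues.mp (h ((hJ i).mpr (Finset.mem_filter.mp hi).2))
        rw [occ_eq, if_pos hi', Nat.sub_self, pow_zero]
      rw [hprod, one_smul, one_smul]
      -- Barred values and non-fixed values of `ω` all lie in `J`, so flipping `J` removes every
      -- bar, and `ω` is `flip J` with its barred values permuted.
      have hv : ω * flip J = ofPerm (absPerm ω) := by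
        refine (eq_ofPerm_of_sgn fun m => ?_).trans
          (by rw [absPerm_mul, absPerm_flip, mul_one])
        rw [sgn_mul, sgn_flip]
        by_cases hm : m ∈ J
        · rw [mem_barredValues.mp (h hm), if_pos, neg_mul_neg, one_mul]
          by_contra hc
          have := hfix' _ hc
          rw [Equiv.apply_symm_apply] at this
          exact hc (this ▸ hm)
        · have e : (absPerm ω).symm m = m := by rw [Equiv.symm_apply_eq, hfix' m hm]
          rw [e, if_neg hm, mul_one]
          exact (Int.units_eq_one_or _).resolve_right fun hc =>
            hm (hsub (mem_barredValues.mpr hc))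
      have hω' : ω = ofPerm (absPerm ω) * flip J := by
        rw [← hv, mul_assoc, flip_mul_flip, mul_one]
      have := basisElt_sub_perm_mul_mem_low hg hA (ω := flip J) (absPerm ω) fun x hx => by
        rw [barredValues_flip]
        by_contra hc
        exact hx (hfix' x hc)
      rw [← hω', bars_flip, hJc] at this
      rw [← neg_sub]
      exact neg_mem this
    · rw [zero_smul, sub_zero]
      refine Submodule.smul_mem _ _ (basisElt_mem_low ?_)
      rw [← hJc]
      exact Finset.card_lt_card ⟨hsub, h⟩
  have hsum := Submodule.sum_mem _ key
  rw [Finset.sum_sub_distrib, hF, zero_sub, ← Finset.sum_smul, Finset.sum_boole, neg_mem_iff]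
    at hsum
  -- The count is nonzero in `ℂ` because `flip J` itself is one of the terms counted.
  refine ((low g (k + 1)).smul_mem_iff ?_).mp hsum
  rw [Nat.cast_ne_zero, ← Nat.pos_iff_ne_zero, Finset.card_pos]
  refine ⟨flip J, Finset.mem_filter.mpr ⟨?_, by rw [barredValues_flip]⟩⟩
  refine Finset.mem_filter.mpr ⟨Finset.mem_univ _, fun a ha => ?_⟩
  rw [flip_apply, if_neg (by rw [hJ]; simp only; omega)]

/-- An `ω` with `k + 1` bars factors as `ofPerm π * flip J * v` with `v` free of bars. Bars add up,
so the drop in degree of `flip J` passes to `ω`. -/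
theorem low_add_two_le {κ : ℂ} {k : ℕ} (hone : ∀ i, n ≤ i → g i = 1)
    (hF : k < n → ∑ ω : B n with ∀ a : Fin n, k + 1 ≤ a.val → ω.1 (a, 1) = (a, 1),
      (∏ i : Fin n with i.val < k + 1, ((i.val : ℂ) - κ) ^ (1 - occ ω i)) • basisElt g ω = 0) :
    low g (k + 2) ≤ low g (k + 1) := by
  refine low_succ_le hg hone le_rfl fun ω hω => ?_
  -- If `n ≤ k`, no signed permutation has `k + 1` bars, so `hF` is needed only for `k < n`.
  have hk : k < n := by have := bars_le ω; omega
  set J : Finset (Fin n) := Finset.univ.filter fun j => j.val < k + 1 with hJ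
  have hJc : J.card = k + 1 := by
    rw [hJ, Fin.card_filter_val_lt]; omega
  have hflip := basisElt_flip_mem_low hg hA (hF hk) (J := J) (by simp [hJ]) hJc
  obtain ⟨π, hπ⟩ := exists_perm_of_card_le (J := J) (I := barredValues ω)
    (by rw [hJc, ← hω]; rfl)
  obtain ⟨v, hv, hb⟩ := exists_eq_ofPerm_mul_flip_mul ω π J hπ
  have h := basisElt_mul_mul hg (ofPerm π) (flip J) v
    (by rw [← hv, bars_ofPerm, bars_flip]; omega)
  rw [← hv, hω] at h
  have h' := mul_mem_low_mul (ofPerm π) v (e := k + 1) (by rw [bars_ofPerm]; omega) hflip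
  convert sub_mem h' h using 1
  abel

end

end Basis

end FusedHecke

namespace FusedHecke

/-! ### The quotient of the Hecke algebra -/

section Quotient

variable (κ : ℂ × ℂ) (n k : ℕ)

noncomputable instance : Ring (Ak κ n k) := RingQuot.instRing (R := A κ n) (AkRel κ n k)

/-- The images of the generators `s_0 = x_1, s_1, …, s_{n-1}`, continued by `1`. -/
noncomputable def quotientGen (i : ℕ) : Ak κ n k :=
  if h : i < n then toAk κ n k (heckeGen κ n ⟨i, h⟩) else 1

variable {κ n k}

theorem quotientGen_of_le {i : ℕ} (h : n ≤ i) : quotientGen κ n k i = 1 := dif_neg (by omega)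

theorem quotientGen_zero (h : 1 ≤ n) :
    quotientGen κ n k 0 = toAk κ n k (heckeX κ n 1 le_rfl h) := by
  rw [quotientGen, dif_pos (show 0 < n from h), heckeGen, dif_pos rfl]

theorem quotientGen_pos {i : ℕ} (h₁ : 1 ≤ i) (h : i < n) :
    quotientGen κ n k i = toAk κ n k (heckeS κ n i h₁ h) := by
  rw [quotientGen, dif_pos h, heckeGen, dif_neg (by simp only; omega)]

theorem basisElt_quotientGen (ω : B n) :
    basisElt (quotientGen κ n k) ω = toAk κ n k (sElt κ ω) := by
  rw [basisElt, natWord, wordProd_map_val, sElt, map_list_prod, List.map_map]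
  congr 2
  funext i
  exact dif_pos i.2

theorem mkAlgHom_eq {a b : FreeAlgebra ℂ (Gen n)} (h : HeckeRel κ n a b) :
    RingQuot.mkAlgHom ℂ (HeckeRel κ n) a = RingQuot.mkAlgHom ℂ (HeckeRel κ n) b :=
  RingQuot.mkAlgHom_rel ℂ h

theorem heckeX_succ (r : ℕ) (hr₁ : 1 ≤ r) (hr₂ : r < n) :
    heckeX κ n (r + 1) (Nat.le_add_left 1 r) hr₂ =
      heckeS κ n r hr₁ hr₂ * heckeX κ n r hr₁ hr₂.le * heckeS κ n r hr₁ hr₂ +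
        heckeS κ n r hr₁ hr₂ := by
  have h := mkAlgHom_eq (HeckeRel.x_succ (κ := κ) r hr₁ hr₂)
  rw [map_add, map_mul, map_mul] at h
  exact h

theorem filteredTypeB_quotientGen : FilteredTypeB n (quotientGen κ n k) where
  sq_zero hn := by
    have h := congrArg (toAk κ n k) (mkAlgHom_eq (HeckeRel.quadratic (κ := κ) hn))
    simp only [map_mul, map_sub, map_zero, AlgHom.commutes] at h
    rw [show toAk κ n k (RingQuot.mkAlgHom ℂ (HeckeRel κ n) (freeX 1 le_rfl hn)) =
      quotientGen κ n k 0 from (quotientGen_zero hn).symm] at h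
    have e : wordProd (quotientGen κ n k) [0, 0] =
        (κ.1 + κ.2) • wordProd (quotientGen κ n k) [0] -
          (κ.1 * κ.2) • wordProd (quotientGen κ n k) [] := by
      simp only [wordProd_cons, wordProd_nil, mul_one]
      rw [Algebra.algebraMap_eq_smul_one, Algebra.algebraMap_eq_smul_one, sub_mul, mul_sub, mul_sub,
        smul_mul_assoc, one_mul, mul_smul_comm, mul_one, smul_mul_assoc, one_mul, smul_smul] at h
      rw [← sub_eq_zero, ← h, add_smul]
      abel
    rw [e]
    exact sub_mem (Submodule.smul_mem _ _ (wordProd_mem_low (by simp [zeros_cons])))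
      (Submodule.smul_mem _ _ (wordProd_mem_low (by simp)))
  sq i h₁ h := by
    have e := congrArg (toAk κ n k) (mkAlgHom_eq (HeckeRel.s_sq (κ := κ) i h₁ h))
    simp only [map_mul, map_one, pow_two] at e
    rw [quotientGen_pos h₁ h]
    exact e
  comm i j hij hj := by
    rw [quotientGen_pos (by omega) hj]
    rcases Nat.eq_zero_or_pos i with rfl | hi
    · rw [quotientGen_zero (by omega)]
      have e := congrArg (toAk κ n k) (mkAlgHom_eq (HeckeRel.x_comm_s (κ := κ) (n := n) 1 j le_rfl
        (by omega) (by omega) hj (by omega) (by omega)))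
      simp only [map_mul] at e
      exact e
    · rw [quotientGen_pos hi (by omega)]
      have e := congrArg (toAk κ n k) (mkAlgHom_eq (HeckeRel.s_comm (κ := κ) (n := n) i j hi
        (by omega) (by omega) hj (by rw [lt_abs]; omega)))
      simp only [map_mul] at e
      exact e
  braid i h₁ h := by
    rw [quotientGen_pos h₁ (by omega), quotientGen_pos (by omega) h]
    have e := congrArg (toAk κ n k) (mkAlgHom_eq (HeckeRel.braid (κ := κ) (n := n) i h₁ h))
    simp only [map_mul] at e
    exact e
  braid_zero hn := by
    -- Substituting `x_2 = s_1 x_1 s_1 + s_1` in `x_1 x_2 = x_2 x_1` gives the braid relation of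
    -- length four up to `s_1 x_1 - x_1 s_1`, which has degree one.
    have e := congrArg (toAk κ n k) (mkAlgHom_eq (HeckeRel.x_comm_x (κ := κ) (n := n) 1 (1 + 1)
      le_rfl (by omega) (by omega) hn))
    simp only [map_mul] at e
    change toAk κ n k (heckeX κ n 1 _ _) * toAk κ n k (heckeX κ n (1 + 1) _ _) =
      toAk κ n k (heckeX κ n (1 + 1) _ _) * toAk κ n k (heckeX κ n 1 _ _) at e
    rw [heckeX_succ 1 le_rfl hn] at e
    simp only [map_mul, map_add] at e
    rw [← quotientGen_zero, ← quotientGen_pos] at e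
    have e' : wordProd (quotientGen κ n k) [0, 1, 0, 1] - wordProd (quotientGen κ n k) [1, 0, 1, 0] =
        wordProd (quotientGen κ n k) [1, 0] - wordProd (quotientGen κ n k) [0, 1] := by
      simp only [wordProd_cons, wordProd_nil, mul_one]
      rw [mul_add, add_mul] at e
      rw [sub_eq_sub_iff_add_eq_add]
      simpa only [mul_assoc, add_comm] using e
    rw [e']
    exact sub_mem (wordProd_mem_low (by simp [zeros_cons])) (wordProd_mem_low (by simp [zeros_cons]))

theorem quotientGen_top_mem_low (hn : 1 < n) :
    wordProd (quotientGen κ n k) [0, 1, 0, 1] - wordProd (quotientGen κ n k) [0, 1, 0] ∈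
      low (quotientGen κ n k) 2 := by
  have e := congrArg (RingQuot.mkAlgHom ℂ (AkRel κ n k)) (RingQuot.mkAlgHom_rel ℂ
    (ARel.rel (κ := κ) (n := n) hn _ _ rfl rfl))
  change toAk κ n k _ = toAk κ n k _ at e
  simp only [map_mul, map_add, map_pow, map_smul, map_sub, map_one] at e
  rw [← quotientGen_zero, ← quotientGen_pos] at e
  set g := quotientGen κ n k with hg
  have e' : wordProd g [0, 1, 0, 1] - wordProd g [0, 1, 0] =
      (κ.1 * (1 + κ.1)) • (wordProd g [1] - wordProd g []) +
        κ.1 • (wordProd g [1, 0, 1] - wordProd g [1, 0]) +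
        (1 + κ.1) • (wordProd g [0] - wordProd g [0, 1]) := by
    simp only [wordProd_cons, wordProd_nil, mul_one, mul_assoc, pow_two] at e ⊢
    rw [e, add_sub_cancel_right]
  rw [e']
  refine add_mem (add_mem ?_ ?_) ?_ <;>
    exact Submodule.smul_mem _ _ (sub_mem (wordProd_mem_low (by simp [zeros_cons]))
      (wordProd_mem_low (by simp [zeros_cons])))

theorem sum_basisElt_quotientGen_eq_zero (h : k < n) :
    ∑ ω : B n with ∀ a : Fin n, k + 1 ≤ a.val → ω.1 (a, 1) = (a, 1),
      (∏ i : Fin n with i.val < k + 1, ((i.val : ℂ) - κ.2) ^ (1 - occ ω i)) •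
        basisElt (quotientGen κ n k) ω = 0 := by
  have e := RingQuot.mkAlgHom_rel ℂ (AkRel.rel (κ := κ) h)
  rw [map_zero] at e
  change toAk κ n k (Ftilde κ n (k + 1)) = 0 at e
  rw [Ftilde, map_sum] at e
  rw [← e]
  refine Finset.sum_congr rfl fun ω _ => ?_
  rw [map_smul, basisElt_quotientGen]

/-- A generator raises the degree by at most one, and `low_add_two_le` brings it back. -/
theorem quotientGen_mul_mem_low (i : ℕ) {a : Ak κ n k} (ha : a ∈ low (quotientGen κ n k) (k + 1)) :
    quotientGen κ n k i * a ∈ low (quotientGen κ n k) (k + 1) := by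
  refine low_add_two_le filteredTypeB_quotientGen quotientGen_top_mem_low
    (fun i => quotientGen_of_le) sum_basisElt_quotientGen_eq_zero ?_
  have := wordProd_mul_mem_low [i] (e := k + 2)
    (by rw [zeros_cons, zeros_nil]; split_ifs <;> omega) ha
  simpa using this

/-- The subspace contains `1`, the empty word, and is stable under left multiplication by every
`s_i` and `x_1`; the recursion `x_{r+1} = s_r x_r s_r + s_r` extends this to every `x_r`. -/
theorem low_quotientGen_eq_top : low (quotientGen κ n k) (k + 1) = ⊤ := by
  set S := low (quotientGen κ n k) (k + 1) with hS
  let φ : FreeAlgebra ℂ (Gen n) →ₐ[ℂ] Ak κ n k :=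
    (toAk κ n k).comp (RingQuot.mkAlgHom ℂ (HeckeRel κ n))
  have hφ : Function.Surjective φ :=
    ((RingQuot.mkAlgHom_surjective ℂ _).comp (RingQuot.mkAlgHom_surjective ℂ _)).comp
      (RingQuot.mkAlgHom_surjective ℂ _)
  have hs : ∀ i h₁ h₂, ∀ a ∈ S, toAk κ n k (heckeS κ n i h₁ h₂) * a ∈ S := fun i h₁ h₂ a ha => by
    rw [← quotientGen_pos h₁ h₂]
    exact quotientGen_mul_mem_low i ha
  have hx : ∀ r h₁ h₂, ∀ a ∈ S, toAk κ n k (heckeX κ n r h₁ h₂) * a ∈ S := by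
    intro r h₁
    induction r, h₁ using Nat.le_induction with
    | base =>
      intro h₂ a ha
      rw [← quotientGen_zero]
      exact quotientGen_mul_mem_low 0 ha
    | succ r hr ih =>
      intro h₂ a ha
      rw [heckeX_succ r hr h₂, map_add, map_mul, map_mul, add_mul, mul_assoc, mul_assoc]
      exact add_mem (hs _ _ _ _ (ih _ _ (hs _ _ _ _ ha))) (hs _ _ _ _ ha)
  have hmul : ∀ a : FreeAlgebra ℂ (Gen n), ∀ b ∈ S, φ a * b ∈ S := by
    intro a
    induction a using FreeAlgebra.induction with
    | grade0 r =>
      intro b hb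
      rw [AlgHom.commutes, ← Algebra.smul_def]
      exact S.smul_mem r hb
    | grade1 x =>
      intro b hb
      cases x with
      | x r h₁ h₂ => exact hx r h₁ h₂ b hb
      | s i h₁ h₂ => exact hs i h₁ h₂ b hb
    | mul a b iha ihb =>
      intro c hc
      rw [map_mul, mul_assoc]
      exact iha _ (ihb _ hc)
    | add a b iha ihb =>
      intro c hc
      rw [map_add, add_mul]
      exact add_mem (iha _ hc) (ihb _ hc)
  rw [eq_top_iff]
  intro a _
  obtain ⟨b, rfl⟩ := hφ a
  simpa using hmul b 1 (wordProd_mem_low (l := []) (Nat.succ_pos k))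

end Quotient

end FusedHecke

theorem mainTheorem7 (κ : ℂ × ℂ) (n k : ℕ) (hk : 1 ≤ k) :
    Submodule.span ℂ
      ((fun ω : FusedHecke.B n => FusedHecke.toAk κ n k (FusedHecke.sElt κ ω)) ''
        FusedHecke.avoiding n k) = ⊤ := by
  have h := FusedHecke.low_le_span_avoiding (FusedHecke.filteredTypeB_quotientGen (κ := κ) (n := n) (k := k))
    FusedHecke.quotientGen_top_mem_low (fun i => FusedHecke.quotientGen_of_le) k (k + 1) le_rfl
  rw [FusedHecke.low_quotientGen_eq_top, top_le_iff] at h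
  rw [← h]
  congr 2
  funext ω
  exact (FusedHecke.basisElt_quotientGen ω).symm
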